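/- Let $G$ be a finite group and $\mathcal{O}$ an indexing system, given by its category of admissible maps: a wide, pullback stable, finite coproduct complete subcategory of the category of finite $G$-sets. An $\mathcal{O}$-Tambara functor $\underline{S}$ has a commutative ring $\underline{S}(X)$ for every finite $G$-set $X$, restrictions $R_f$ and transfers $T_f$ for all equivariant maps $f$, and norms $N_f$ for the admissible ones, subject to the usual relations (functoriality, additivity on disjoint unions, double coset formulas, Frobenius reciprocity, Tambara reciprocity). Let $\boxtimes$ be the box product, which is the coproduct of $\mathcal{O}$-Tambara functors, and $\boxtimes_{\underline{A}}$ the box product over $\underline{A}$ (the pushout). For $H\le G$ let $\underline{A}^{\mathcal{O}}[x_H]=P_{\mathcal{O}}(G/H,-)$ be the $\mathcal{O}$-Tambara functor represented by $G/H$: it is generated by the polynomials $G/H\leftarrow A\to B\to X$ with $A\to B$ admissible (additive inverses being adjoined), and $\mathrm{Id}\in\underline{A}^{\mathcal{O}}[x_H](G/H)$ is the identity polynomial. For a morphism $\phi:\underline{A}\to\underline{B}$ of $\mathcal{O}$-Tambara functors and a $\underline{B}$-module $\underline{M}$, let $\operatorname{Der}_\phi(\underline{B},\underline{M})$ be the group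 of $\mathcal{O}$-genuine derivations: maps of Mackey functors $d:\underline{B}\to\underline{M}$ with $d\circ\phi=0$ and $d(N_f(s))=T_f\big(N_{\pi_2}R_{\pi_1}(s)\cdot d(s)\big)$ for all admissible $f:X\to Y$ and $s\in\underline{B}(X)$, where $\pi_1,\pi_2:X\times_YX\setminus\Delta(X)\to X$ are the projections. The $\underline{B}$-module of Kähler differentials is $\Omega_{\underline{A}|\underline{B}}=\underline{I}/\underline{I}^{>1}$, where $\underline{I}$ is the kernel of the multiplication $\underline{B}\boxtimes_{\underline{A}}\underline{B}\to\underline{B}$ and $\underline{I}^{>1}$ is the smallest ideal containing all $N_f(i)$ with $i\in\underline{I}(X)$ and $f:X\to Y$ admissible with all fibres of cardinality at least $2$; put $\delta(b)=\overline{1\otimes b-b\otimes 1}$. A $\underline{B}$-module $\underline{M}$ is free on elements $e_i\in\underline{M}(X_i)$ if for every $\underline{B}$-module $\underline{N}$ and all $n_i\in\underline{N}(X_i)$ there is a unique $\underline{B}$-module map $\underline{M}\to\underline{N}$ with $e_i\mapsto n_i$ for all $i$. Let $\underline{R}$ be an $\mathcal{O}$-Tambara functor. 1. Let $H\le G$,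 let $\underline{S}=\underline{R}\boxtimes\underline{A}^{\mathcal{O}}[x_H]$ and let $\phi:\underline{R}\to\underline{S}$ be the inclusion $r\mapsto r\otimes1$. For every $\underline{S}$-module $\underline{M}$ the map $$\operatorname{Der}_\phi(\underline{S},\underline{M})\longrightarrow\underline{M}(G/H),\qquad d\mapsto d(1\otimes\mathrm{Id}),$$ is an isomorphism of abelian groups. 2. In the situation of 1, $\Omega_{\underline{R}|\underline{S}}$ is the free $\underline{S}$-module on a single generator at $G/H$, namely $\delta(1\otimes\mathrm{Id})$. 3. Let $H_1,\dots,H_n\le G$ and let $\underline{S}=\underline{R}\boxtimes\big(\underline{A}^{\mathcal{O}}[x_{H_1}]\boxtimes\cdots\boxtimes\underline{A}^{\mathcal{O}}[x_{H_n}]\big)$. Then $\Omega_{\underline{R}|\underline{S}}$ is the free $\underline{S}$-module on one generator at each $G/H_i$, namely $\delta(1\otimes x_i)$, where $x_i$ is the identity polynomial in the $i$-th factor. -/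

import Mathlib

universe u v w w' w''

/-! ## Finite `G`-sets -/

/-- A finite `G`-set. Morphisms of finite `G`-sets are equivariant maps `X →[G] Y`. -/
structure FinGSet (G : Type u) [Group G] where
  carrier : Type u
  [action : MulAction G carrier]
  [finite : Finite carrier]

namespace FinGSet

variable {G : Type u} [Group G]

instance : CoeSort (FinGSet G) (Type u) := ⟨FinGSet.carrier⟩

attribute [instance] FinGSet.action FinGSet.finite

/-- The orbit `G/H`. -/
def orbit [Finite G] (H : Subgroup G) : FinGSet G := ⟨G ⧸ H⟩

/-- The empty `G`-set. -/
def empty : FinGSet G :=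
  letI : MulAction G PEmpty.{u + 1} :=
    { smul := fun _ x => x, one_smul := fun _ => rfl, mul_smul := fun _ _ _ => rfl }
  ⟨PEmpty.{u + 1}⟩

/-- The disjoint union of two finite `G`-sets. -/
def coprod (X Y : FinGSet G) : FinGSet G := ⟨X ⊕ Y⟩

/-- The identity of a finite `G`-set. -/
def idHom (X : FinGSet G) : X →[G] X := MulActionHom.id G

def inl (X Y : FinGSet G) : X →[G] coprod X Y where
  toFun := Sum.inl
  map_smul' _ _ := rfl

def inr (X Y : FinGSet G) : Y →[G] coprod X Y where
  toFun := Sum.inr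
  map_smul' _ _ := rfl

/-- The map out of a disjoint union given by `f` and `g`. -/
def desc {X Y Z : FinGSet G} (f : X →[G] Z) (g : Y →[G] Z) : coprod X Y →[G] Z where
  toFun := Sum.elim f g
  map_smul' a x := by
    cases x with
    | inl x => exact map_smul f a x
    | inr x => exact map_smul g a x

/-- The commutative square
```
  P --g'--> X
  |f'       |f
  v         v
  Y' --g--> Y
```
is a pullback square of finite `G`-sets. -/
def IsPullback {P X Y' Y : FinGSet G} (g' : P →[G] X) (f' : P →[G] Y') (f : X →[G] Y)
    (g : Y' →[G] Y) : Prop :=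
  (∀ q, f (g' q) = g (f' q)) ∧ ∀ x y', f x = g y' → ∃! q, g' q = x ∧ f' q = y'

/-- The diagram
```
  X <--h-- A <--e-- Q
  |g                |g'
  v                 v
  Y <------h'------ P
```
is an exponential diagram: `P` is the `G`-set of pairs `(y, s)` with `y ∈ Y` and `s` a section of
`h` over the fibre `g⁻¹(y)`, the map `h'` is `(y, s) ↦ y`, `Q` is the fibre product `X ×_Y P`,
`g'` is its projection to `P`, and `e (x, (y, s)) = s x`. It is given up to isomorphism: the points
of `P` over `y` are in bijection with the sections `s` over `g⁻¹(y)`, through the rule that `e`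
takes the value `s x` at the point of `Q` over `x` and `p`. -/
def IsExponential {X Y A Q P : FinGSet G} (h : A →[G] X) (g : X →[G] Y) (e : Q →[G] A)
    (g' : Q →[G] P) (h' : P →[G] Y) : Prop :=
  IsPullback (h.comp e) g' g h' ∧
    ∀ (y : Y) (s : {x : X // g x = y} → A), (∀ x, h (s x) = x.1) →
      ∃! p : P, h' p = y ∧ ∀ (q : Q) (x : {x : X // g x = y}), g' q = p → h (e q) = x.1 → e q = s x

/-- The complement `X ×_Y X - Δ(X)` of the diagonal in the fibre product. -/
def offDiag {X Y : FinGSet G} (f : X →[G] Y) : FinGSet G :=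
  letI : MulAction G {p : X × X // f p.1 = f p.2 ∧ p.1 ≠ p.2} :=
    { smul := fun a p => ⟨(a • p.1.1, a • p.1.2), by
        rw [map_smul, map_smul, p.2.1], fun h => p.2.2 (MulAction.injective a h)⟩
      one_smul := fun p => Subtype.ext (Prod.ext (one_smul G p.1.1) (one_smul G p.1.2))
      mul_smul := fun a b p =>
        Subtype.ext (Prod.ext (mul_smul a b p.1.1) (mul_smul a b p.1.2)) }
  ⟨{p : X × X // f p.1 = f p.2 ∧ p.1 ≠ p.2}⟩

/-- The first projection of `X ×_Y X - Δ(X)`. -/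
def offDiagFst {X Y : FinGSet G} (f : X →[G] Y) : offDiag f →[G] X where
  toFun p := p.1.1
  map_smul' _ _ := rfl

/-- The second projection of `X ×_Y X - Δ(X)`. -/
def offDiagSnd {X Y : FinGSet G} (f : X →[G] Y) : offDiag f →[G] X where
  toFun p := p.1.2
  map_smul' _ _ := rfl

/-- `f` is 2-surjective: every fibre has at least two elements. -/
def TwoSurjective {X Y : FinGSet G} (f : X →[G] Y) : Prop :=
  ∀ y : Y, ∃ x x' : X, x ≠ x' ∧ f x = y ∧ f x' = y

end FinGSet

open FinGSet

/-- A wide, pullback stable, finite coproduct complete subcategory of finite `G`-sets. These are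
in bijection with the indexing systems `𝒪`; the maps in the subcategory are the `𝒪`-admissible
maps. -/
structure IndexingCategory (G : Type u) [Group G] where
  adm : ∀ {X Y : FinGSet G}, (X →[G] Y) → Prop
  adm_id : ∀ X : FinGSet G, adm (idHom X)
  adm_comp : ∀ {X Y Z : FinGSet G} (g : Y →[G] Z) (f : X →[G] Y), adm g → adm f → adm (g.comp f)
  adm_pullback : ∀ {P X Y' Y : FinGSet G} (g' : P →[G] X) (f' : P →[G] Y') (f : X →[G] Y)
    (g : Y' →[G] Y), IsPullback g' f' f g → adm f → adm f'
  adm_empty : ∀ {X Y : FinGSet G} (f : X →[G] Y), IsEmpty X → adm f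
  adm_inl : ∀ X Y : FinGSet G, adm (inl X Y)
  adm_inr : ∀ X Y : FinGSet G, adm (inr X Y)
  adm_desc : ∀ {X Y Z : FinGSet G} (f : X →[G] Z) (g : Y →[G] Z), adm f → adm g → adm (desc f g)

namespace IndexingCategory

variable {G : Type u} [Group G] (D : IndexingCategory G)

/-- Bijective equivariant maps are admissible. -/
theorem adm_of_bijective {X Y : FinGSet G} (f : X →[G] Y) (hf : Function.Bijective f) :
    D.adm f := by
  refine D.adm_pullback f f (idHom Y) (idHom Y) ⟨fun _ => rfl, ?_⟩ (D.adm_id Y)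
  intro x y hxy
  obtain ⟨q, hq⟩ := hf.2 x
  have hxy' : x = y := hxy
  subst hxy'
  exact ⟨q, ⟨hq, hq⟩, fun q' h => hf.1 (h.1.trans hq.symm)⟩

/-- The second projection of `X ×_Y X - Δ(X)` is admissible if `X → Y` is. -/
theorem adm_offDiagSnd {X Y : FinGSet G} (f : X →[G] Y) (hf : D.adm f) :
    D.adm (offDiagSnd f) := by
  classical
  -- the fibre product `X ×_Y X` is the disjoint union of `X ×_Y X - Δ(X)` and `X`
  let π₁ : coprod (offDiag f) X →[G] X := desc (offDiagFst f) (idHom X)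
  let π₂ : coprod (offDiag f) X →[G] X := desc (offDiagSnd f) (idHom X)
  have hp : IsPullback π₁ π₂ f f := by
    refine ⟨?_, ?_⟩
    · rintro (q | q)
      · exact q.2.1
      · rfl
    · intro x y hxy
      by_cases h : x = y
      · refine ⟨Sum.inr x, ⟨rfl, h⟩, ?_⟩
        rintro (q | q) ⟨h1, h2⟩
        · exact absurd ((show q.1.1 = x from h1).trans (h.trans (show q.1.2 = y from h2).symm))
            q.2.2
        · exact congrArg Sum.inr h1
      · refine ⟨Sum.inl ⟨(x, y), hxy, h⟩, ⟨rfl, rfl⟩, ?_⟩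
        rintro (q | q) ⟨h1, h2⟩
        · exact congrArg Sum.inl (Subtype.ext (Prod.ext h1 h2))
        · exact absurd ((show q = x from h1).symm.trans (show q = y from h2)) h
  have h2 : D.adm π₂ := D.adm_pullback π₁ π₂ f f hp hf
  exact D.adm_comp π₂ (inl (offDiag f) X) h2 (D.adm_inl _ _)

end IndexingCategory

/-! ## `𝒪`-Tambara functors and modules -/

/-- An `𝒪`-Tambara functor: a commutative ring for every finite `G`-set, with restrictions and
transfers for all equivariant maps and norms for all admissible ones, which turns disjoint unions
into products and satisfies functoriality, the double coset formulas (for all pullback squares),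
Frobenius reciprocity and the Tambara relation (for all exponential diagrams). -/
structure TambaraFunctor {G : Type u} [Group G] (D : IndexingCategory G) where
  obj : FinGSet G → Type w
  [ring : ∀ X, CommRing (obj X)]
  res : ∀ {X Y : FinGSet G}, (X →[G] Y) → (obj Y →+* obj X)
  tr : ∀ {X Y : FinGSet G}, (X →[G] Y) → (obj X →+ obj Y)
  nm : ∀ {X Y : FinGSet G} (f : X →[G] Y), D.adm f → (obj X →* obj Y)
  res_id : ∀ (X : FinGSet G) (a : obj X), res (idHom X) a = a
  res_comp : ∀ {X Y Z : FinGSet G} (g : Y →[G] Z) (f : X →[G] Y) (a : obj Z),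
    res (g.comp f) a = res f (res g a)
  tr_id : ∀ (X : FinGSet G) (a : obj X), tr (idHom X) a = a
  tr_comp : ∀ {X Y Z : FinGSet G} (g : Y →[G] Z) (f : X →[G] Y) (a : obj X),
    tr (g.comp f) a = tr g (tr f a)
  nm_id : ∀ (X : FinGSet G) (a : obj X), nm (idHom X) (D.adm_id X) a = a
  nm_comp : ∀ {X Y Z : FinGSet G} (g : Y →[G] Z) (f : X →[G] Y) (hg : D.adm g) (hf : D.adm f)
    (a : obj X), nm (g.comp f) (D.adm_comp g f hg hf) a = nm g hg (nm f hf a)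
  res_tr : ∀ {P X Y' Y : FinGSet G} (g' : P →[G] X) (f' : P →[G] Y') (f : X →[G] Y)
    (g : Y' →[G] Y), IsPullback g' f' f g → ∀ a : obj X, res g (tr f a) = tr f' (res g' a)
  res_nm : ∀ {P X Y' Y : FinGSet G} (g' : P →[G] X) (f' : P →[G] Y') (f : X →[G] Y)
    (g : Y' →[G] Y) (hp : IsPullback g' f' f g) (hf : D.adm f) (a : obj X),
    res g (nm f hf a) = nm f' (D.adm_pullback g' f' f g hp hf) (res g' a)
  tr_mul_res : ∀ {X Y : FinGSet G} (f : X →[G] Y) (a : obj X) (b : obj Y),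
    tr f (a * res f b) = tr f a * b
  nm_tr : ∀ {X Y A Q P : FinGSet G} (h : A →[G] X) (g : X →[G] Y) (e : Q →[G] A)
    (g' : Q →[G] P) (h' : P →[G] Y) (he : IsExponential h g e g' h') (hg : D.adm g) (a : obj A),
    nm g hg (tr h a) = tr h' (nm g' (D.adm_pullback _ g' g h' he.1 hg) (res e a))
  subsingleton_of_isEmpty : ∀ X : FinGSet G, IsEmpty X → Subsingleton (obj X)
  coprod_bijective : ∀ X Y : FinGSet G,
    Function.Bijective fun a : obj (coprod X Y) => (res (inl X Y) a, res (inr X Y) a)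

attribute [instance] TambaraFunctor.ring

namespace TambaraFunctor

variable {G : Type u} [Group G] {D : IndexingCategory G}

/-- A morphism of `𝒪`-Tambara functors. -/
structure Hom (R : TambaraFunctor.{u, w} D) (S : TambaraFunctor.{u, w'} D) where
  app : ∀ X : FinGSet G, R.obj X →+* S.obj X
  app_res : ∀ {X Y : FinGSet G} (f : X →[G] Y) (a : R.obj Y), app X (R.res f a) = S.res f (app Y a)
  app_tr : ∀ {X Y : FinGSet G} (f : X →[G] Y) (a : R.obj X), app Y (R.tr f a) = S.tr f (app X a)
  app_nm : ∀ {X Y : FinGSet G} (f : X →[G] Y) (hf : D.adm f) (a : R.obj X),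
    app Y (R.nm f hf a) = S.nm f hf (app X a)

/-- A module over an `𝒪`-Tambara functor `S`: a Mackey functor with an `S(X)`-module structure on
the value at `X` that is compatible with restrictions and satisfies the two Frobenius
reciprocity laws. -/
structure Mod (S : TambaraFunctor.{u, w} D) where
  obj : FinGSet G → Type w'
  [addCommGroup : ∀ X, AddCommGroup (obj X)]
  [module : ∀ X, Module (S.obj X) (obj X)]
  res : ∀ {X Y : FinGSet G}, (X →[G] Y) → (obj Y →+ obj X)
  tr : ∀ {X Y : FinGSet G}, (X →[G] Y) → (obj X →+ obj Y)
  res_id : ∀ (X : FinGSet G) (m : obj X), res (idHom X) m = m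
  res_comp : ∀ {X Y Z : FinGSet G} (g : Y →[G] Z) (f : X →[G] Y) (m : obj Z),
    res (g.comp f) m = res f (res g m)
  tr_id : ∀ (X : FinGSet G) (m : obj X), tr (idHom X) m = m
  tr_comp : ∀ {X Y Z : FinGSet G} (g : Y →[G] Z) (f : X →[G] Y) (m : obj X),
    tr (g.comp f) m = tr g (tr f m)
  res_tr : ∀ {P X Y' Y : FinGSet G} (g' : P →[G] X) (f' : P →[G] Y') (f : X →[G] Y)
    (g : Y' →[G] Y), IsPullback g' f' f g → ∀ m : obj X, res g (tr f m) = tr f' (res g' m)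
  subsingleton_of_isEmpty : ∀ X : FinGSet G, IsEmpty X → Subsingleton (obj X)
  coprod_bijective : ∀ X Y : FinGSet G,
    Function.Bijective fun m : obj (coprod X Y) => (res (inl X Y) m, res (inr X Y) m)
  res_smul : ∀ {X Y : FinGSet G} (f : X →[G] Y) (s : S.obj Y) (m : obj Y),
    res f (s • m) = S.res f s • res f m
  smul_tr : ∀ {X Y : FinGSet G} (f : X →[G] Y) (s : S.obj Y) (m : obj X),
    s • tr f m = tr f (S.res f s • m)
  tr_smul : ∀ {X Y : FinGSet G} (f : X →[G] Y) (s : S.obj X) (m : obj Y),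
    S.tr f s • m = tr f (s • res f m)

attribute [instance] Mod.addCommGroup Mod.module

/-- A homomorphism of `S`-modules. -/
structure Mod.Hom {S : TambaraFunctor.{u, w} D} (M : Mod.{u, w, w'} S) (N : Mod.{u, w, w''} S) where
  app : ∀ X : FinGSet G, M.obj X →ₗ[S.obj X] N.obj X
  app_res : ∀ {X Y : FinGSet G} (f : X →[G] Y) (m : M.obj Y), app X (M.res f m) = N.res f (app Y m)
  app_tr : ∀ {X Y : FinGSet G} (f : X →[G] Y) (m : M.obj X), app Y (M.tr f m) = N.tr f (app X m)

/-- The elements `e i ∈ M(X i)` form a basis of the `S`-module `M`, i.e. `M` is the free `S`-module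
on the generators `e i`: every choice of elements `n i ∈ N(X i)` of an `S`-module `N` is the
image of the `e i` under a unique homomorphism `M → N`. -/
def Mod.IsBasis {S : TambaraFunctor.{u, w} D} (M : Mod.{u, w, w'} S) {ι : Type v}
    (X : ι → FinGSet G) (e : ∀ i, M.obj (X i)) : Prop :=
  ∀ (N : Mod.{u, w, w''} S) (n : ∀ i, N.obj (X i)),
    ∃! F : Mod.Hom M N, ∀ i, F.app (X i) (e i) = n i

/-! ## Genuine derivations -/

/-- The group of `𝒪`-genuine `A`-derivations `S → M`, for a morphism `φ : A → S`: maps of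
Mackey functors that vanish on `A` and satisfy `d (N_f s) = T_f (N_{π₂} R_{π₁} s • d s)` for all
admissible `f : X → Y`, where `π₁, π₂ : X ×_Y X - Δ(X) → X` are the projections. -/
def Der {A : TambaraFunctor.{u, w} D} {S : TambaraFunctor.{u, w'} D} (φ : Hom A S)
    (M : Mod.{u, w', w''} S) : AddSubgroup (∀ X : FinGSet G, S.obj X →+ M.obj X) where
  carrier := {d |
    (∀ {X Y : FinGSet G} (f : X →[G] Y) (s : S.obj Y), d X (S.res f s) = M.res f (d Y s)) ∧
    (∀ {X Y : FinGSet G} (f : X →[G] Y) (s : S.obj X), d Y (S.tr f s) = M.tr f (d X s)) ∧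
    (∀ (X : FinGSet G) (a : A.obj X), d X (φ.app X a) = 0) ∧
    (∀ {X Y : FinGSet G} (f : X →[G] Y) (hf : D.adm f) (s : S.obj X),
      d Y (S.nm f hf s) =
        M.tr f (S.nm (offDiagSnd f) (D.adm_offDiagSnd f hf) (S.res (offDiagFst f) s) • d X s))}
  zero_mem' := by
    refine ⟨?_, ?_, ?_, ?_⟩ <;> intros <;> simp
  add_mem' := by
    rintro d d' ⟨h1, h2, h3, h4⟩ ⟨h1', h2', h3', h4'⟩
    refine ⟨?_, ?_, ?_, ?_⟩
    · intro X Y f s; simp [h1, h1']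
    · intro X Y f s; simp [h2, h2']
    · intro X a; simp [h3, h3']
    · intro X Y f hf s; simp [h4 f hf, h4' f hf]
  neg_mem' := by
    rintro d ⟨h1, h2, h3, h4⟩
    refine ⟨?_, ?_, ?_, ?_⟩
    · intro X Y f s; simp [h1]
    · intro X Y f s; simp [h2]
    · intro X a; simp [h3]
    · intro X Y f hf s; simp [h4 f hf]

/-- Evaluation of derivations at an element: `d ↦ d x`. -/
def Der.eval {A : TambaraFunctor.{u, w} D} {S : TambaraFunctor.{u, w'} D} (φ : Hom A S)
    (M : Mod.{u, w', w''} S) {X : FinGSet G} (x : S.obj X) : Der φ M →+ M.obj X where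
  toFun d := d.1 X x
  map_zero' := rfl
  map_add' _ _ := rfl

/-! ## `𝒪`-Tambara functors given by generators and relations -/

section Presentation

variable (D)

/-- Formal expressions at `X` in the operations of an `𝒪`-Tambara functor and symbols
from `gen`. -/
inductive Term (gen : FinGSet G → Type v) : FinGSet G → Type (max (u + 1) v)
  | of {X : FinGSet G} (a : gen X) : Term gen X
  | zero {X : FinGSet G} : Term gen X
  | one {X : FinGSet G} : Term gen X
  | add {X : FinGSet G} (a b : Term gen X) : Term gen X
  | mul {X : FinGSet G} (a b : Term gen X) : Term gen X
  | neg {X : FinGSet G} (a : Term gen X) : Term gen X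
  | res {X Y : FinGSet G} (f : X →[G] Y) (a : Term gen Y) : Term gen X
  | tr {X Y : FinGSet G} (f : X →[G] Y) (a : Term gen X) : Term gen Y
  | nm {X Y : FinGSet G} (f : X →[G] Y) (hf : D.adm f) (a : Term gen X) : Term gen Y

variable {D} {gen : FinGSet G → Type v}

/-- The smallest congruence on formal expressions that contains the given relations and all
identities that hold in every `𝒪`-Tambara functor. -/
inductive Term.Rel (rel : ∀ X : FinGSet G, Term D gen X → Term D gen X → Prop) :
    ∀ {X : FinGSet G}, Term D gen X → Term D gen X → Prop
  | of {X : FinGSet G} {a b : Term D gen X} : rel X a b → Rel rel a b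
  | refl {X : FinGSet G} (a : Term D gen X) : Rel rel a a
  | symm {X : FinGSet G} {a b : Term D gen X} : Rel rel a b → Rel rel b a
  | trans {X : FinGSet G} {a b c : Term D gen X} : Rel rel a b → Rel rel b c → Rel rel a c
  | add_congr {X : FinGSet G} {a a' b b' : Term D gen X} :
      Rel rel a a' → Rel rel b b' → Rel rel (.add a b) (.add a' b')
  | mul_congr {X : FinGSet G} {a a' b b' : Term D gen X} :
      Rel rel a a' → Rel rel b b' → Rel rel (.mul a b) (.mul a' b')
  | neg_congr {X : FinGSet G} {a a' : Term D gen X} : Rel rel a a' → Rel rel (.neg a) (.neg a')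
  | res_congr {X Y : FinGSet G} (f : X →[G] Y) {a a' : Term D gen Y} :
      Rel rel a a' → Rel rel (.res f a) (.res f a')
  | tr_congr {X Y : FinGSet G} (f : X →[G] Y) {a a' : Term D gen X} :
      Rel rel a a' → Rel rel (.tr f a) (.tr f a')
  | nm_congr {X Y : FinGSet G} (f : X →[G] Y) (hf : D.adm f) {a a' : Term D gen X} :
      Rel rel a a' → Rel rel (.nm f hf a) (.nm f hf a')
  | add_assoc {X : FinGSet G} (a b c : Term D gen X) :
      Rel rel (.add (.add a b) c) (.add a (.add b c))
  | add_comm {X : FinGSet G} (a b : Term D gen X) : Rel rel (.add a b) (.add b a)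
  | zero_add {X : FinGSet G} (a : Term D gen X) : Rel rel (.add .zero a) a
  | neg_add {X : FinGSet G} (a : Term D gen X) : Rel rel (.add (.neg a) a) .zero
  | mul_assoc {X : FinGSet G} (a b c : Term D gen X) :
      Rel rel (.mul (.mul a b) c) (.mul a (.mul b c))
  | mul_comm {X : FinGSet G} (a b : Term D gen X) : Rel rel (.mul a b) (.mul b a)
  | one_mul {X : FinGSet G} (a : Term D gen X) : Rel rel (.mul .one a) a
  | mul_add {X : FinGSet G} (a b c : Term D gen X) :
      Rel rel (.mul a (.add b c)) (.add (.mul a b) (.mul a c))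
  | res_add {X Y : FinGSet G} (f : X →[G] Y) (a b : Term D gen Y) :
      Rel rel (.res f (.add a b)) (.add (.res f a) (.res f b))
  | res_mul {X Y : FinGSet G} (f : X →[G] Y) (a b : Term D gen Y) :
      Rel rel (.res f (.mul a b)) (.mul (.res f a) (.res f b))
  | res_one {X Y : FinGSet G} (f : X →[G] Y) : Rel rel (.res f .one) .one
  | tr_add {X Y : FinGSet G} (f : X →[G] Y) (a b : Term D gen X) :
      Rel rel (.tr f (.add a b)) (.add (.tr f a) (.tr f b))
  | nm_mul {X Y : FinGSet G} (f : X →[G] Y) (hf : D.adm f) (a b : Term D gen X) :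
      Rel rel (.nm f hf (.mul a b)) (.mul (.nm f hf a) (.nm f hf b))
  | nm_one {X Y : FinGSet G} (f : X →[G] Y) (hf : D.adm f) : Rel rel (.nm f hf .one) .one
  | res_id {X : FinGSet G} (a : Term D gen X) : Rel rel (.res (idHom X) a) a
  | res_comp {X Y Z : FinGSet G} (g : Y →[G] Z) (f : X →[G] Y) (a : Term D gen Z) :
      Rel rel (.res (g.comp f) a) (.res f (.res g a))
  | tr_id {X : FinGSet G} (a : Term D gen X) : Rel rel (.tr (idHom X) a) a
  | tr_comp {X Y Z : FinGSet G} (g : Y →[G] Z) (f : X →[G] Y) (a : Term D gen X) :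
      Rel rel (.tr (g.comp f) a) (.tr g (.tr f a))
  | nm_id {X : FinGSet G} (a : Term D gen X) : Rel rel (.nm (idHom X) (D.adm_id X) a) a
  | nm_comp {X Y Z : FinGSet G} (g : Y →[G] Z) (f : X →[G] Y) (hg : D.adm g) (hf : D.adm f)
      (a : Term D gen X) :
      Rel rel (.nm (g.comp f) (D.adm_comp g f hg hf) a) (.nm g hg (.nm f hf a))
  | res_tr {P X Y' Y : FinGSet G} (g' : P →[G] X) (f' : P →[G] Y') (f : X →[G] Y)
      (g : Y' →[G] Y) (hp : IsPullback g' f' f g) (a : Term D gen X) :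
      Rel rel (.res g (.tr f a)) (.tr f' (.res g' a))
  | res_nm {P X Y' Y : FinGSet G} (g' : P →[G] X) (f' : P →[G] Y') (f : X →[G] Y)
      (g : Y' →[G] Y) (hp : IsPullback g' f' f g) (hf : D.adm f) (a : Term D gen X) :
      Rel rel (.res g (.nm f hf a)) (.nm f' (D.adm_pullback g' f' f g hp hf) (.res g' a))
  | tr_mul_res {X Y : FinGSet G} (f : X →[G] Y) (a : Term D gen X) (b : Term D gen Y) :
      Rel rel (.tr f (.mul a (.res f b))) (.mul (.tr f a) b)
  | nm_tr {X Y A Q P : FinGSet G} (h : A →[G] X) (g : X →[G] Y) (e : Q →[G] A) (g' : Q →[G] P)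
      (h' : P →[G] Y) (he : IsExponential h g e g' h') (hg : D.adm g) (a : Term D gen A) :
      Rel rel (.nm g hg (.tr h a))
        (.tr h' (.nm g' (D.adm_pullback _ g' g h' he.1 hg) (.res e a)))
  | eq_zero_of_isEmpty {X : FinGSet G} (hX : IsEmpty X) (a : Term D gen X) : Rel rel a .zero
  | coprod_decomp {X Y : FinGSet G} (a : Term D gen (coprod X Y)) :
      Rel rel a
        (.add (.tr (inl X Y) (.res (inl X Y) a)) (.tr (inr X Y) (.res (inr X Y) a)))

def Term.setoid (rel : ∀ X : FinGSet G, Term D gen X → Term D gen X → Prop)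
    (X : FinGSet G) : Setoid (Term D gen X) :=
  ⟨Term.Rel rel, .refl, .symm, .trans⟩

/-- The value at `X` of the `𝒪`-Tambara functor with generators `gen` and relations `rel`. -/
def Presented.Obj (rel : ∀ X : FinGSet G, Term D gen X → Term D gen X → Prop)
    (X : FinGSet G) : Type (max (u + 1) v) :=
  Quotient (Term.setoid rel X)

/-- The class of a formal expression. -/
def Presented.mk (rel : ∀ X : FinGSet G, Term D gen X → Term D gen X → Prop)
    {X : FinGSet G} (a : Term D gen X) : Presented.Obj rel X :=
  Quotient.mk (Term.setoid rel X) a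

theorem Presented.sound {rel : ∀ X : FinGSet G, Term D gen X → Term D gen X → Prop}
    {X : FinGSet G} {a b : Term D gen X} (h : Term.Rel rel a b) :
    Presented.mk rel a = Presented.mk rel b :=
  Quotient.sound h

theorem Presented.ind {rel : ∀ X : FinGSet G, Term D gen X → Term D gen X → Prop}
    {X : FinGSet G} {p : Presented.Obj rel X → Prop} (h : ∀ a, p (Presented.mk rel a))
    (x : Presented.Obj rel X) : p x :=
  Quotient.ind h x

section

variable (rel : ∀ X : FinGSet G, Term D gen X → Term D gen X → Prop) (X : FinGSet G)

instance : Zero (Presented.Obj rel X) := ⟨Presented.mk rel .zero⟩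

instance : One (Presented.Obj rel X) := ⟨Presented.mk rel .one⟩

instance : Add (Presented.Obj rel X) := ⟨Quotient.map₂ .add fun _ _ h _ _ h' => .add_congr h h'⟩

instance : Mul (Presented.Obj rel X) := ⟨Quotient.map₂ .mul fun _ _ h _ _ h' => .mul_congr h h'⟩

instance : Neg (Presented.Obj rel X) := ⟨Quotient.map .neg fun _ _ h => .neg_congr h⟩

instance : CommRing (Presented.Obj rel X) :=
  CommRing.ofMinimalAxioms
    (by rintro ⟨a⟩ ⟨b⟩ ⟨c⟩; exact Presented.sound (.add_assoc a b c))
    (by rintro ⟨a⟩; exact Presented.sound (.zero_add a))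
    (by rintro ⟨a⟩; exact Presented.sound (.neg_add a))
    (by rintro ⟨a⟩ ⟨b⟩ ⟨c⟩; exact Presented.sound (.mul_assoc a b c))
    (by rintro ⟨a⟩ ⟨b⟩; exact Presented.sound (.mul_comm a b))
    (by rintro ⟨a⟩; exact Presented.sound (.one_mul a))
    (by rintro ⟨a⟩ ⟨b⟩ ⟨c⟩; exact Presented.sound (.mul_add a b c))

end

variable {rel : ∀ X : FinGSet G, Term D gen X → Term D gen X → Prop}

/-- Restrictions of classes of formal expressions. -/
def Presented.res {X Y : FinGSet G} (f : X →[G] Y) :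
    Presented.Obj rel Y →+* Presented.Obj rel X :=
  RingHom.mk'
    { toFun := Quotient.map (.res f) fun _ _ h => .res_congr f h
      map_one' := Presented.sound (.res_one f)
      map_mul' := by rintro ⟨a⟩ ⟨b⟩; exact Presented.sound (.res_mul f a b) }
    (by rintro ⟨a⟩ ⟨b⟩; exact Presented.sound (.res_add f a b))

/-- Transfers of classes of formal expressions. -/
def Presented.tr {X Y : FinGSet G} (f : X →[G] Y) :
    Presented.Obj rel X →+ Presented.Obj rel Y :=
  AddMonoidHom.mk' (Quotient.map (.tr f) fun _ _ h => .tr_congr f h)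
    (by rintro ⟨a⟩ ⟨b⟩; exact Presented.sound (.tr_add f a b))

theorem Presented.eq_zero_of_isEmpty {X : FinGSet G} (hX : IsEmpty X)
    (x : Presented.Obj rel X) : x = 0 := by
  obtain ⟨a⟩ := x
  exact Presented.sound (.eq_zero_of_isEmpty hX a)

theorem Presented.res_tr {P X Y' Y : FinGSet G} (g' : P →[G] X) (f' : P →[G] Y') (f : X →[G] Y)
    (g : Y' →[G] Y) (hp : IsPullback g' f' f g) (x : Presented.Obj rel X) :
    Presented.res g (Presented.tr f x) = Presented.tr f' (Presented.res g' x) := by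
  obtain ⟨a⟩ := x
  exact Presented.sound (.res_tr g' f' f g hp a)

theorem Presented.res_tr_of_injective {X Y : FinGSet G} (f : X →[G] Y)
    (hf : Function.Injective f) (x : Presented.Obj rel X) :
    Presented.res f (Presented.tr f x) = x := by
  rw [Presented.res_tr (idHom X) (idHom X) f f ⟨fun _ => rfl, fun y y' h =>
    ⟨y, ⟨rfl, hf h⟩, fun _ hq => hq.1⟩⟩]
  obtain ⟨a⟩ := x
  exact Presented.sound (.trans (.tr_id _) (.res_id a))

theorem Presented.res_tr_of_disjoint {X X' Y : FinGSet G} (f : X →[G] Y) (g : X' →[G] Y)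
    (hfg : ∀ x x', f x ≠ g x') (x : Presented.Obj rel X) :
    Presented.res g (Presented.tr f x) = 0 := by
  let i : empty (G := G) →[G] X := ⟨fun z => z.elim, fun _ z => z.elim⟩
  let j : empty (G := G) →[G] X' := ⟨fun z => z.elim, fun _ z => z.elim⟩
  rw [Presented.res_tr i j f g ⟨fun z => z.elim, fun y y' h => absurd h (hfg y y')⟩,
    Presented.eq_zero_of_isEmpty (X := empty) ⟨fun z => z.elim⟩ (Presented.res i x), map_zero]

/-- The `𝒪`-Tambara functor with generators `gen` and relations `rel`. -/
def Presented (rel : ∀ X : FinGSet G, Term D gen X → Term D gen X → Prop) :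
    TambaraFunctor.{u, max (u + 1) v} D where
  obj := Presented.Obj rel
  res := Presented.res
  tr := Presented.tr
  nm f hf :=
    { toFun := Quotient.map (.nm f hf) fun _ _ h => .nm_congr f hf h
      map_one' := Presented.sound (.nm_one f hf)
      map_mul' := by rintro ⟨a⟩ ⟨b⟩; exact Presented.sound (.nm_mul f hf a b) }
  res_id := by rintro X ⟨a⟩; exact Presented.sound (.res_id a)
  res_comp := by rintro X Y Z g f ⟨a⟩; exact Presented.sound (.res_comp g f a)
  tr_id := by rintro X ⟨a⟩; exact Presented.sound (.tr_id a)
  tr_comp := by rintro X Y Z g f ⟨a⟩; exact Presented.sound (.tr_comp g f a)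
  nm_id := by rintro X ⟨a⟩; exact Presented.sound (.nm_id a)
  nm_comp := by rintro X Y Z g f hg hf ⟨a⟩; exact Presented.sound (.nm_comp g f hg hf a)
  res_tr := by rintro P X Y' Y g' f' f g hp ⟨a⟩; exact Presented.sound (.res_tr g' f' f g hp a)
  res_nm := by
    rintro P X Y' Y g' f' f g hp hf ⟨a⟩; exact Presented.sound (.res_nm g' f' f g hp hf a)
  tr_mul_res := by rintro X Y f ⟨a⟩ ⟨b⟩; exact Presented.sound (.tr_mul_res f a b)
  nm_tr := by
    rintro X Y A Q P h g e g' h' he hg ⟨a⟩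
    exact Presented.sound (.nm_tr h g e g' h' he hg a)
  subsingleton_of_isEmpty X hX :=
    ⟨fun x y => (Presented.eq_zero_of_isEmpty hX x).trans
      (Presented.eq_zero_of_isEmpty hX y).symm⟩
  coprod_bijective X Y := by
    have key : ∀ x : Presented.Obj rel (coprod X Y),
        x = Presented.tr (inl X Y) (Presented.res (inl X Y) x) +
          Presented.tr (inr X Y) (Presented.res (inr X Y) x) := by
      rintro ⟨a⟩; exact Presented.sound (.coprod_decomp a)
    have hl : Function.Injective (inl X Y) := Sum.inl_injective
    have hr : Function.Injective (inr X Y) := Sum.inr_injective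
    refine ⟨fun x y h => ?_, fun p => ⟨Presented.tr (inl X Y) p.1 + Presented.tr (inr X Y) p.2, ?_⟩⟩
    · have h1 : Presented.res (inl X Y) x = Presented.res (inl X Y) y := congrArg Prod.fst h
      have h2 : Presented.res (inr X Y) x = Presented.res (inr X Y) y := congrArg Prod.snd h
      rw [key x, key y, h1, h2]
    · refine Prod.ext ?_ ?_
      · change Presented.res (inl X Y) (_ + _) = _
        rw [map_add, Presented.res_tr_of_injective _ hl,
          Presented.res_tr_of_disjoint _ _ (fun _ _ => Sum.inr_ne_inl), add_zero]
      · change Presented.res (inr X Y) (_ + _) = _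
        rw [map_add, Presented.res_tr_of_injective _ hr,
          Presented.res_tr_of_disjoint _ _ (fun _ _ => Sum.inl_ne_inr), zero_add]

end Presentation

/-! ### Maps out of a presented functor -/

section Lift

variable (S : TambaraFunctor.{u, w} D)

theorem res_tr_of_injective {X Y : FinGSet G} (f : X →[G] Y) (hf : Function.Injective f)
    (x : S.obj X) : S.res f (S.tr f x) = x := by
  rw [S.res_tr (idHom X) (idHom X) f f ⟨fun _ => rfl, fun y y' h =>
    ⟨y, ⟨rfl, hf h⟩, fun _ hq => hq.1⟩⟩, S.tr_id, S.res_id]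

theorem res_tr_of_disjoint {X X' Y : FinGSet G} (f : X →[G] Y) (g : X' →[G] Y)
    (hfg : ∀ x x', f x ≠ g x') (x : S.obj X) : S.res g (S.tr f x) = 0 := by
  let i : empty (G := G) →[G] X := ⟨fun z => z.elim, fun _ z => z.elim⟩
  let j : empty (G := G) →[G] X' := ⟨fun z => z.elim, fun _ z => z.elim⟩
  have := S.subsingleton_of_isEmpty empty ⟨fun z => z.elim⟩
  rw [S.res_tr i j f g ⟨fun z => z.elim, fun y y' h => absurd h (hfg y y')⟩,
    Subsingleton.elim (S.res i x) 0, map_zero]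

theorem coprod_decomp {X Y : FinGSet G} (x : S.obj (coprod X Y)) :
    x = S.tr (inl X Y) (S.res (inl X Y) x) + S.tr (inr X Y) (S.res (inr X Y) x) := by
  refine (S.coprod_bijective X Y).1 (Prod.ext ?_ ?_)
  · change S.res (inl X Y) x = S.res (inl X Y) (_ + _)
    rw [map_add, S.res_tr_of_injective _ Sum.inl_injective,
      S.res_tr_of_disjoint _ _ (fun _ _ => Sum.inr_ne_inl), add_zero]
  · change S.res (inr X Y) x = S.res (inr X Y) (_ + _)
    rw [map_add, S.res_tr_of_injective _ Sum.inr_injective,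
      S.res_tr_of_disjoint _ _ (fun _ _ => Sum.inl_ne_inr), zero_add]

variable {gen : FinGSet G → Type v}

/-- The value of a formal expression under an assignment of values to the generators. -/
def Term.eval (val : ∀ X : FinGSet G, gen X → S.obj X) :
    ∀ {X : FinGSet G}, Term D gen X → S.obj X
  | _, .of a => val _ a
  | _, .zero => 0
  | _, .one => 1
  | _, .add a b => Term.eval val a + Term.eval val b
  | _, .mul a b => Term.eval val a * Term.eval val b
  | _, .neg a => -Term.eval val a
  | _, .res f a => S.res f (Term.eval val a)
  | _, .tr f a => S.tr f (Term.eval val a)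
  | _, .nm f hf a => S.nm f hf (Term.eval val a)

variable {rel : ∀ X : FinGSet G, Term D gen X → Term D gen X → Prop}

theorem Term.eval_eq_of_rel (val : ∀ X : FinGSet G, gen X → S.obj X)
    (hval : ∀ (X : FinGSet G) (a b : Term D gen X), rel X a b →
      Term.eval S val a = Term.eval S val b)
    {X : FinGSet G} {a b : Term D gen X} (h : Term.Rel rel a b) :
    Term.eval S val a = Term.eval S val b := by
  induction h with
  | of h => exact hval _ _ _ h
  | refl => rfl
  | symm _ ih => exact ih.symm
  | trans _ _ ih1 ih2 => exact ih1.trans ih2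
  | add_congr _ _ ih1 ih2 => simp only [Term.eval, ih1, ih2]
  | mul_congr _ _ ih1 ih2 => simp only [Term.eval, ih1, ih2]
  | neg_congr _ ih => simp only [Term.eval, ih]
  | res_congr f _ ih => simp only [Term.eval, ih]
  | tr_congr f _ ih => simp only [Term.eval, ih]
  | nm_congr f hf _ ih => simp only [Term.eval, ih]
  | add_assoc a b c => exact _root_.add_assoc _ _ _
  | add_comm a b => exact _root_.add_comm _ _
  | zero_add a => exact _root_.zero_add _
  | neg_add a => exact neg_add_cancel _
  | mul_assoc a b c => exact _root_.mul_assoc _ _ _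
  | mul_comm a b => exact _root_.mul_comm _ _
  | one_mul a => exact _root_.one_mul _
  | mul_add a b c => exact _root_.mul_add _ _ _
  | res_add f a b => exact map_add _ _ _
  | res_mul f a b => exact map_mul _ _ _
  | res_one f => exact map_one _
  | tr_add f a b => exact map_add _ _ _
  | nm_mul f hf a b => exact map_mul _ _ _
  | nm_one f hf => exact map_one _
  | res_id a => exact S.res_id _ _
  | res_comp g f a => exact S.res_comp _ _ _
  | tr_id a => exact S.tr_id _ _
  | tr_comp g f a => exact S.tr_comp _ _ _
  | nm_id a => exact S.nm_id _ _
  | nm_comp g f hg hf a => exact S.nm_comp _ _ _ _ _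
  | res_tr g' f' f g hp a => exact S.res_tr _ _ _ _ hp _
  | res_nm g' f' f g hp hf a => exact S.res_nm _ _ _ _ hp _ _
  | tr_mul_res f a b => exact S.tr_mul_res _ _ _
  | nm_tr h g e g' h' he hg a => exact S.nm_tr _ _ _ _ _ he _ _
  | eq_zero_of_isEmpty hX a =>
    have := S.subsingleton_of_isEmpty _ hX
    exact Subsingleton.elim _ _
  | coprod_decomp a => exact S.coprod_decomp _

/-- The morphism out of a presented functor given by values of the generators that satisfy the
relations. -/
def Presented.lift (val : ∀ X : FinGSet G, gen X → S.obj X)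
    (hval : ∀ (X : FinGSet G) (a b : Term D gen X), rel X a b →
      Term.eval S val a = Term.eval S val b) : Hom (Presented rel) S where
  app X :=
    { toFun := Quotient.lift (Term.eval S val) fun _ _ h => Term.eval_eq_of_rel S val hval h
      map_zero' := rfl
      map_one' := rfl
      map_add' := by rintro ⟨a⟩ ⟨b⟩; rfl
      map_mul' := by rintro ⟨a⟩ ⟨b⟩; rfl }
  app_res := by rintro X Y f ⟨a⟩; rfl
  app_tr := by rintro X Y f ⟨a⟩; rfl
  app_nm := by rintro X Y f hf ⟨a⟩; rfl

end Lift

end TambaraFunctor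

/-! ## Polynomials and free `𝒪`-Tambara functors -/

/-- A polynomial `Z <--c-- A --b--> B --p--> X` with exponents restricted to the admissible maps,
that is, with `b` admissible. -/
structure Bispan {G : Type u} [Group G] (D : IndexingCategory G) (Z X : FinGSet G) where
  A : FinGSet G
  B : FinGSet G
  c : A →[G] Z
  b : A →[G] B
  p : B →[G] X
  adm : D.adm b

namespace Bispan

variable {G : Type u} [Group G] {D : IndexingCategory G}

/-- Two polynomials are isomorphic if there are isomorphisms (bijective equivariant maps) `A ≅ A'`
and `B ≅ B'` that are compatible with the structure maps. -/
def Iso {Z X : FinGSet G} (P P' : Bispan D Z X) : Prop :=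
  ∃ (α : P.A →[G] P'.A) (β : P.B →[G] P'.B), Function.Bijective α ∧ Function.Bijective β ∧
    (∀ a, P'.c (α a) = P.c a) ∧ (∀ a, P'.b (α a) = β (P.b a)) ∧ ∀ b, P'.p (β b) = P.p b

theorem Iso.refl {Z X : FinGSet G} (P : Bispan D Z X) : P.Iso P :=
  ⟨idHom _, idHom _, Function.bijective_id, Function.bijective_id, fun _ => rfl, fun _ => rfl,
    fun _ => rfl⟩

theorem Iso.symm {Z X : FinGSet G} {P P' : Bispan D Z X} (h : P.Iso P') : P'.Iso P := by
  obtain ⟨α, β, hα, hβ, h1, h2, h3⟩ := h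
  obtain ⟨α', hl, hr⟩ := Function.bijective_iff_has_inverse.1 hα
  obtain ⟨β', hl', hr'⟩ := Function.bijective_iff_has_inverse.1 hβ
  refine ⟨α.inverse α' hl hr, β.inverse β' hl' hr', ⟨hr.injective, hl.surjective⟩,
    ⟨hr'.injective, hl'.surjective⟩, fun a => ?_, fun a => ?_, fun b => ?_⟩
  · change P.c (α' a) = _
    rw [← h1, hr]
  · change P.b (α' a) = β' (P'.b a)
    rw [← hl' (P.b (α' a)), ← h2, hr]
  · change P.p (β' b) = _
    rw [← h3, hr']

theorem Iso.trans {Z X : FinGSet G} {P P' P'' : Bispan D Z X} (h : P.Iso P') (h' : P'.Iso P'') :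
    P.Iso P'' := by
  obtain ⟨α, β, hα, hβ, h1, h2, h3⟩ := h
  obtain ⟨α', β', hα', hβ', h1', h2', h3'⟩ := h'
  refine ⟨α'.comp α, β'.comp β, hα'.comp hα, hβ'.comp hβ, fun a => ?_, fun a => ?_, fun b => ?_⟩
  · exact (h1' _).trans (h1 _)
  · exact (h2' _).trans (congrArg β' (h2 _))
  · exact (h3' _).trans (h3 _)

/-- Isomorphism of polynomials as an equivalence relation. -/
def setoid (D : IndexingCategory G) (Z X : FinGSet G) : Setoid (Bispan D Z X) :=
  ⟨Iso, Iso.refl, Iso.symm, Iso.trans⟩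

/-- The identity polynomial of `Z`. -/
def id (D : IndexingCategory G) (Z : FinGSet G) : Bispan D Z Z :=
  ⟨Z, Z, idHom Z, idHom Z, idHom Z, D.adm_id Z⟩

/-- `P'` represents the composite `T_f ∘ P`. -/
def IsTr {Z X Y : FinGSet G} (f : X →[G] Y) (P : Bispan D Z X) (P' : Bispan D Z Y) : Prop :=
  P' = ⟨P.A, P.B, P.c, P.b, f.comp P.p, P.adm⟩

/-- `P'` represents the composite `R_f ∘ P`: it is obtained from `P = [Z <- A -> B -> Y]` by pulling
back `A -> B -> Y` along `f : X → Y`. -/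
def IsRes {Z X Y : FinGSet G} (f : X →[G] Y) (P : Bispan D Z Y) (P' : Bispan D Z X) : Prop :=
  ∃ (α : P'.A →[G] P.A) (β : P'.B →[G] P.B),
    IsPullback α P'.b P.b β ∧ IsPullback β P'.p P.p f ∧ P'.c = P.c.comp α

/-- `P'` represents the composite `N_f ∘ P`: for `P = [Z <-c- A -b-> B -p-> X]`, an exponential
diagram `B <-e- Q -g'-> B' -p'-> Y` of `B -p-> X -f-> Y` and the fibre product `A' = A ×_B Q`, it is
`[Z <- A' -> B' -p'-> Y]` with the composite maps `A' -> A -c-> Z` and `A' -> Q -g'-> B'`. -/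
def IsNm {Z X Y : FinGSet G} (f : X →[G] Y) (P : Bispan D Z X) (P' : Bispan D Z Y) : Prop :=
  ∃ (Q : FinGSet G) (e : Q →[G] P.B) (g' : Q →[G] P'.B) (α : P'.A →[G] P.A) (b' : P'.A →[G] Q),
    IsExponential P.p f e g' P'.p ∧ IsPullback α b' P.b e ∧
      P'.c = P.c.comp α ∧ P'.b = g'.comp b'

end Bispan

/-- The set `P_𝒪(Z, X)` of morphisms `Z → X` in the category of polynomials with exponents
restricted to the admissible maps: isomorphism classes of polynomials. -/
def PolyHom {G : Type u} [Group G] (D : IndexingCategory G) (Z X : FinGSet G) : Type (u + 1) :=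
  Quotient (Bispan.setoid D Z X)

/-- The class of a polynomial. -/
def PolyHom.mk {G : Type u} [Group G] {D : IndexingCategory G} {Z X : FinGSet G}
    (P : Bispan D Z X) : PolyHom D Z X :=
  Quotient.mk (Bispan.setoid D Z X) P

namespace TambaraFunctor

variable {G : Type u} [Group G] {D : IndexingCategory G}

/-- The relations which say that the restrictions, transfers and norms of polynomials are given by
composition of polynomials. -/
inductive PolyRel (D : IndexingCategory G) (Z : FinGSet G) :
    ∀ X : FinGSet G, Term D (PolyHom D Z) X → Term D (PolyHom D Z) X → Prop
  | res {X Y : FinGSet G} (f : X →[G] Y) (P : Bispan D Z Y) (P' : Bispan D Z X) :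
      P.IsRes f P' → PolyRel D Z X (.res f (.of (.mk P))) (.of (.mk P'))
  | tr {X Y : FinGSet G} (f : X →[G] Y) (P : Bispan D Z X) (P' : Bispan D Z Y) :
      P.IsTr f P' → PolyRel D Z Y (.tr f (.of (.mk P))) (.of (.mk P'))
  | nm {X Y : FinGSet G} (f : X →[G] Y) (hf : D.adm f) (P : Bispan D Z X) (P' : Bispan D Z Y) :
      P.IsNm f P' → PolyRel D Z Y (.nm f hf (.of (.mk P))) (.of (.mk P'))

/-- The `𝒪`-Tambara functor `A^𝒪[x_Z] = P_𝒪(Z, -)` represented by the finite `G`-set `Z`: it is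
generated by the polynomials in `P_𝒪(Z, X)`, with restrictions, transfers and norms (and hence
sums and products, which are transfers and norms along fold maps) given by composition, and
additive inverses adjoined. -/
def free (D : IndexingCategory G) (Z : FinGSet G) : TambaraFunctor.{u, u + 1} D :=
  Presented.{u, u + 1} (PolyRel D Z)

/-- The identity polynomial, as an element of `A^𝒪[x_Z](Z)`. -/
def freeId (D : IndexingCategory G) (Z : FinGSet G) : (free D Z).obj Z :=
  Presented.mk (PolyRel D Z) (.of (.mk (Bispan.id D Z)))

/-! ## Box products -/

/-- The symbol `m ⊗ n`. -/
def tmul (R : TambaraFunctor.{u, w} D) (T : TambaraFunctor.{u, w'} D) {X : FinGSet G}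
    (m : R.obj X) (n : T.obj X) : Term D (fun X => R.obj X × T.obj X) X :=
  .of (m, n)

/-- The relations of the box product `R ⊠ T`: bilinearity and Frobenius reciprocity, and the rules
for restrictions, products and norms of the symbols `m ⊗ n`. -/
inductive BoxRel (R : TambaraFunctor.{u, w} D) (T : TambaraFunctor.{u, w'} D) :
    ∀ X : FinGSet G, Term D (fun X => R.obj X × T.obj X) X →
      Term D (fun X => R.obj X × T.obj X) X → Prop
  | add_tmul {X : FinGSet G} (m m' : R.obj X) (n : T.obj X) :
      BoxRel R T X (tmul R T (m + m') n) (.add (tmul R T m n) (tmul R T m' n))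
  | tmul_add {X : FinGSet G} (m : R.obj X) (n n' : T.obj X) :
      BoxRel R T X (tmul R T m (n + n')) (.add (tmul R T m n) (tmul R T m n'))
  | tr_tmul {X Y : FinGSet G} (f : X →[G] Y) (m : R.obj X) (n : T.obj Y) :
      BoxRel R T Y (tmul R T (R.tr f m) n) (.tr f (tmul R T m (T.res f n)))
  | tmul_tr {X Y : FinGSet G} (f : X →[G] Y) (m : R.obj Y) (n : T.obj X) :
      BoxRel R T Y (tmul R T m (T.tr f n)) (.tr f (tmul R T (R.res f m) n))
  | res {X Y : FinGSet G} (f : X →[G] Y) (m : R.obj Y) (n : T.obj Y) :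
      BoxRel R T X (.res f (tmul R T m n)) (tmul R T (R.res f m) (T.res f n))
  | one {X : FinGSet G} : BoxRel R T X .one (tmul R T 1 1)
  | mul {X : FinGSet G} (m m' : R.obj X) (n n' : T.obj X) :
      BoxRel R T X (.mul (tmul R T m n) (tmul R T m' n')) (tmul R T (m * m') (n * n'))
  | nm {X Y : FinGSet G} (f : X →[G] Y) (hf : D.adm f) (m : R.obj X) (n : T.obj X) :
      BoxRel R T Y (.nm f hf (tmul R T m n)) (tmul R T (R.nm f hf m) (T.nm f hf n))

/-- The box product `R ⊠ T` of two `𝒪`-Tambara functors. It is the coproduct in the category of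
`𝒪`-Tambara functors. -/
def box (R : TambaraFunctor.{u, w} D) (T : TambaraFunctor.{u, w'} D) :
    TambaraFunctor.{u, max (u + 1) w w'} D :=
  Presented (BoxRel R T)

/-- The relations of the box product over `A`: those of `B ⊠ C` and `(b a) ⊗ c = b ⊗ (a c)`. -/
inductive RelBoxRel {A : TambaraFunctor.{u, w} D} {B : TambaraFunctor.{u, w'} D}
    {C : TambaraFunctor.{u, w''} D} (φ : Hom A B) (ψ : Hom A C) :
    ∀ X : FinGSet G, Term D (fun X => B.obj X × C.obj X) X →
      Term D (fun X => B.obj X × C.obj X) X → Prop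
  | box {X : FinGSet G} (a b : Term D (fun X => B.obj X × C.obj X) X) :
      BoxRel B C X a b → RelBoxRel φ ψ X a b
  | balance {X : FinGSet G} (b : B.obj X) (a : A.obj X) (c : C.obj X) :
      RelBoxRel φ ψ X (tmul B C (b * φ.app X a) c) (tmul B C b (ψ.app X a * c))

/-- The box product `B ⊠_A C` over `A` of two `A`-algebras `φ : A → B` and `ψ : A → C`. It is the
pushout in the category of `𝒪`-Tambara functors. -/
def relBox {A : TambaraFunctor.{u, w} D} {B : TambaraFunctor.{u, w'} D}
    {C : TambaraFunctor.{u, w''} D} (φ : Hom A B) (ψ : Hom A C) :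
    TambaraFunctor.{u, max (u + 1) w' w''} D :=
  Presented (RelBoxRel φ ψ)

section Inclusions

variable {R : TambaraFunctor.{u, w} D} {T : TambaraFunctor.{u, w'} D}

/-- The map `r ↦ r ⊗ 1` into the functor with generators `m ⊗ n` and relations containing those of
the box product. -/
def tmulLeft (rel : ∀ X : FinGSet G, Term D (fun X => R.obj X × T.obj X) X →
      Term D (fun X => R.obj X × T.obj X) X → Prop)
    (h : ∀ X a b, BoxRel R T X a b → rel X a b) : Hom R (Presented rel) where
  app X := RingHom.mk'
    { toFun := fun r => Presented.mk rel (tmul R T r 1)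
      map_one' := Presented.sound (.symm (.of (h _ _ _ .one)))
      map_mul' := fun r r' => by
        have := Presented.sound (.of (h _ _ _ (.mul r r' (1 : T.obj X) 1)))
        rw [mul_one] at this
        exact this.symm }
    (fun r r' => Presented.sound (.of (h _ _ _ (.add_tmul r r' 1))))
  app_res {X Y} f r := by
    have := Presented.sound (.of (h _ _ _ (.res f r (1 : T.obj Y))))
    rw [map_one] at this
    exact this.symm
  app_tr {X Y} f r := by
    have := Presented.sound (.of (h _ _ _ (.tr_tmul f r (1 : T.obj Y))))
    rw [map_one] at this
    exact this
  app_nm {X Y} f hf r := by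
    have := Presented.sound (.of (h _ _ _ (.nm f hf r (1 : T.obj X))))
    rw [map_one] at this
    exact this.symm

/-- The map `t ↦ 1 ⊗ t` into the functor with generators `m ⊗ n` and relations containing those of
the box product. -/
def tmulRight (rel : ∀ X : FinGSet G, Term D (fun X => R.obj X × T.obj X) X →
      Term D (fun X => R.obj X × T.obj X) X → Prop)
    (h : ∀ X a b, BoxRel R T X a b → rel X a b) : Hom T (Presented rel) where
  app X := RingHom.mk'
    { toFun := fun t => Presented.mk rel (tmul R T 1 t)
      map_one' := Presented.sound (.symm (.of (h _ _ _ .one)))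
      map_mul' := fun t t' => by
        have := Presented.sound (.of (h _ _ _ (.mul (1 : R.obj X) 1 t t')))
        rw [mul_one] at this
        exact this.symm }
    (fun t t' => Presented.sound (.of (h _ _ _ (.tmul_add 1 t t'))))
  app_res {X Y} f t := by
    have := Presented.sound (.of (h _ _ _ (.res f (1 : R.obj Y) t)))
    rw [map_one] at this
    exact this.symm
  app_tr {X Y} f t := by
    have := Presented.sound (.of (h _ _ _ (.tmul_tr f (1 : R.obj Y) t)))
    rw [map_one] at this
    exact this
  app_nm {X Y} f hf t := by
    have := Presented.sound (.of (h _ _ _ (.nm f hf (1 : R.obj X) t)))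
    rw [map_one] at this
    exact this.symm

variable (R T) in
/-- The inclusion `R → R ⊠ T`, `r ↦ r ⊗ 1`. -/
def boxInl : Hom R (box R T) := tmulLeft (BoxRel R T) fun _ _ _ h => h

variable (R T) in
/-- The inclusion `T → R ⊠ T`, `t ↦ 1 ⊗ t`. -/
def boxInr : Hom T (box R T) := tmulRight (BoxRel R T) fun _ _ _ h => h

end Inclusions

section RelativeBox

variable {A : TambaraFunctor.{u, w} D} {B : TambaraFunctor.{u, w'} D} (φ : Hom A B)

/-- The map `B → B ⊠_A B`, `b ↦ b ⊗ 1`. -/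
def relBoxInl : Hom B (relBox φ φ) := tmulLeft (RelBoxRel φ φ) fun _ _ _ h => .box _ _ h

/-- The map `B → B ⊠_A B`, `b ↦ 1 ⊗ b`. -/
def relBoxInr : Hom B (relBox φ φ) := tmulRight (RelBoxRel φ φ) fun _ _ _ h => .box _ _ h

/-- The map `μ : B ⊠_A B → B`, `b ⊗ b' ↦ b * b'`, which restricts to the identity of `B` along both
inclusions. -/
def relBoxMul : Hom (relBox φ φ) B :=
  Presented.lift B (fun _ p => p.1 * p.2) (by
    rintro X a b (⟨_, _, h⟩ | ⟨b, a, c⟩)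
    · cases h with
      | add_tmul m m' n => exact add_mul _ _ _
      | tmul_add m n n' => exact mul_add _ _ _
      | tr_tmul f m n => exact (B.tr_mul_res f m n).symm
      | tmul_tr f m n =>
        change m * B.tr f n = B.tr f (B.res f m * n)
        rw [mul_comm, mul_comm (B.res f m), B.tr_mul_res]
      | res f m n => exact map_mul _ _ _
      | one => exact (one_mul _).symm
      | mul m m' n n' => exact mul_mul_mul_comm _ _ _ _
      | nm f hf m n => exact map_mul _ _ _
    · exact mul_assoc _ _ _)

end RelativeBox

/-! ## Ideals and Kähler differentials -/

/-- An ideal of `S`: ideals of the rings `S(X)` that are preserved by restrictions and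
transfers. -/
structure IdealFamily (S : TambaraFunctor.{u, w} D) where
  carrier : ∀ X : FinGSet G, Ideal (S.obj X)
  res_mem : ∀ {X Y : FinGSet G} (f : X →[G] Y) {a : S.obj Y}, a ∈ carrier Y → S.res f a ∈ carrier X
  tr_mem : ∀ {X Y : FinGSet G} (f : X →[G] Y) {a : S.obj X}, a ∈ carrier X → S.tr f a ∈ carrier Y

/-- The kernel of a morphism. -/
def Hom.ker {R : TambaraFunctor.{u, w} D} {S : TambaraFunctor.{u, w'} D} (F : Hom R S) :
    IdealFamily R where
  carrier X := RingHom.ker (F.app X)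
  res_mem f a ha := by
    rw [RingHom.mem_ker] at ha ⊢
    rw [F.app_res, ha, map_zero]
  tr_mem f a ha := by
    rw [RingHom.mem_ker] at ha ⊢
    rw [F.app_tr, ha, map_zero]

namespace IdealFamily

variable {S : TambaraFunctor.{u, w} D}

/-- The ideal `I^{>1}`: the smallest ideal of `S` that contains the norms `N_f i` of all elements
`i` of `I` along all 2-surjective admissible maps `f`. -/
def gtOne (I : IdealFamily S) : IdealFamily S :=
  let P : IdealFamily S → Prop := fun J =>
    ∀ {X Y : FinGSet G} (f : X →[G] Y) (hf : D.adm f), TwoSurjective f →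
      ∀ i ∈ I.carrier X, S.nm f hf i ∈ J.carrier Y
  { carrier := fun X => ⨅ (J : IdealFamily S) (_ : P J), J.carrier X
    res_mem := fun f a ha => by
      simp only [Submodule.mem_iInf] at ha ⊢
      exact fun J hJ => J.res_mem f (ha J hJ)
    tr_mem := fun f a ha => by
      simp only [Submodule.mem_iInf] at ha ⊢
      exact fun J hJ => J.tr_mem f (ha J hJ) }

variable (I J : IdealFamily S)

/-- Restrictions of elements of `I`. -/
def resHom {X Y : FinGSet G} (f : X →[G] Y) : I.carrier Y →+ I.carrier X where
  toFun a := ⟨S.res f a.1, I.res_mem f a.2⟩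
  map_zero' := Subtype.ext (show S.res f 0 = 0 from map_zero _)
  map_add' a b := Subtype.ext (map_add (S.res f) a.1 b.1)

/-- Transfers of elements of `I`. -/
def trHom {X Y : FinGSet G} (f : X →[G] Y) : I.carrier X →+ I.carrier Y where
  toFun a := ⟨S.tr f a.1, I.tr_mem f a.2⟩
  map_zero' := Subtype.ext (show S.tr f 0 = 0 from map_zero _)
  map_add' a b := Subtype.ext (map_add (S.tr f) a.1 b.1)

/-- The submodule `I(X) ∩ J(X)` of `I(X)`. -/
def inter (X : FinGSet G) : Submodule (S.obj X) (I.carrier X) :=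
  Submodule.comap (I.carrier X).subtype (J.carrier X)

/-- The quotient `I / (I ∩ J)`, as an `S`-module; for `J ⊆ I` this is `I / J`. -/
def quotient : Mod.{u, w, w} S where
  obj X := I.carrier X ⧸ I.inter J X
  res f := QuotientAddGroup.map (I.inter J _).toAddSubgroup (I.inter J _).toAddSubgroup
    (I.resHom f) fun _ ha => J.res_mem f ha
  tr f := QuotientAddGroup.map (I.inter J _).toAddSubgroup (I.inter J _).toAddSubgroup
    (I.trHom f) fun _ ha => J.tr_mem f ha
  res_id := by
    rintro X ⟨a⟩; exact congrArg (Submodule.Quotient.mk (p := I.inter J X))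
      (Subtype.ext (S.res_id X a))
  res_comp := by
    rintro X Y Z g f ⟨a⟩; exact congrArg (Submodule.Quotient.mk (p := I.inter J X))
      (Subtype.ext (S.res_comp g f a))
  tr_id := by
    rintro X ⟨a⟩; exact congrArg (Submodule.Quotient.mk (p := I.inter J X))
      (Subtype.ext (S.tr_id X a))
  tr_comp := by
    rintro X Y Z g f ⟨a⟩; exact congrArg (Submodule.Quotient.mk (p := I.inter J Z))
      (Subtype.ext (S.tr_comp g f a))
  res_tr := by
    rintro P X Y' Y g' f' f g hp ⟨a⟩
    exact congrArg (Submodule.Quotient.mk (p := I.inter J Y')) (Subtype.ext (S.res_tr _ _ _ _ hp a))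
  subsingleton_of_isEmpty X hX := by
    have := S.subsingleton_of_isEmpty X hX
    refine ⟨?_⟩
    rintro ⟨a⟩ ⟨b⟩
    exact congrArg (Submodule.Quotient.mk (p := I.inter J X)) (Subsingleton.elim a b)
  coprod_bijective X Y := by
    refine ⟨?_, ?_⟩
    · rintro ⟨a⟩ ⟨b⟩ hab
      have h1 : S.res (inl X Y) (a - b : S.obj (coprod X Y)) ∈ J.carrier X := by
        rw [map_sub]; exact (Submodule.Quotient.eq (I.inter J X)).1 (congrArg Prod.fst hab)
      have h2 : S.res (inr X Y) (a - b : S.obj (coprod X Y)) ∈ J.carrier Y := by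
        rw [map_sub]; exact (Submodule.Quotient.eq (I.inter J Y)).1 (congrArg Prod.snd hab)
      refine (Submodule.Quotient.eq (I.inter J _)).2 ?_
      change (a - b : S.obj (coprod X Y)) ∈ J.carrier _
      rw [S.coprod_decomp (a - b : S.obj (coprod X Y))]
      exact add_mem (J.tr_mem _ h1) (J.tr_mem _ h2)
    · rintro ⟨⟨a⟩, ⟨b⟩⟩
      refine ⟨Submodule.Quotient.mk (I.trHom (inl X Y) a + I.trHom (inr X Y) b), ?_⟩
      refine Prod.ext ?_ ?_
      · refine congrArg (Submodule.Quotient.mk (p := I.inter J X)) (Subtype.ext ?_)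
        change S.res (inl X Y) (S.tr (inl X Y) a + S.tr (inr X Y) b) = a
        rw [map_add, S.res_tr_of_injective _ Sum.inl_injective,
          S.res_tr_of_disjoint _ _ (fun _ _ => Sum.inr_ne_inl), add_zero]
      · refine congrArg (Submodule.Quotient.mk (p := I.inter J Y)) (Subtype.ext ?_)
        change S.res (inr X Y) (S.tr (inl X Y) a + S.tr (inr X Y) b) = b
        rw [map_add, S.res_tr_of_injective _ Sum.inr_injective,
          S.res_tr_of_disjoint _ _ (fun _ _ => Sum.inl_ne_inr), zero_add]
  res_smul := by
    rintro X Y f s ⟨a⟩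
    exact congrArg (Submodule.Quotient.mk (p := I.inter J X))
      (Subtype.ext (map_mul (S.res f) s a))
  smul_tr := by
    rintro X Y f s ⟨a⟩
    refine congrArg (Submodule.Quotient.mk (p := I.inter J Y)) (Subtype.ext ?_)
    change s * S.tr f a = S.tr f (S.res f s * a)
    rw [mul_comm, mul_comm (S.res f s), S.tr_mul_res]
  tr_smul := by
    rintro X Y f s ⟨a⟩
    exact congrArg (Submodule.Quotient.mk (p := I.inter J Y))
      (Subtype.ext (S.tr_mul_res f s a).symm)

end IdealFamily

/-- Restriction of scalars along a morphism `F : R → S`. -/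
def Mod.restrictScalars {R : TambaraFunctor.{u, w} D} {S : TambaraFunctor.{u, w'} D}
    (F : TambaraFunctor.Hom R S) (M : Mod.{u, w', w''} S) : Mod.{u, w, w''} R :=
  letI : ∀ X, Module (R.obj X) (M.obj X) := fun X => Module.compHom (M.obj X) (F.app X)
  { obj := M.obj
    res := M.res
    tr := M.tr
    res_id := M.res_id
    res_comp := M.res_comp
    tr_id := M.tr_id
    tr_comp := M.tr_comp
    res_tr := M.res_tr
    subsingleton_of_isEmpty := M.subsingleton_of_isEmpty
    coprod_bijective := M.coprod_bijective
    res_smul := fun f s m => by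
      change M.res f (F.app _ s • m) = F.app _ (R.res f s) • M.res f m
      rw [M.res_smul, F.app_res]
    smul_tr := fun f s m => by
      change F.app _ s • M.tr f m = M.tr f (F.app _ (R.res f s) • m)
      rw [M.smul_tr, F.app_res]
    tr_smul := fun f s m => by
      change F.app _ (R.tr f s) • m = M.tr f (F.app _ s • M.res f m)
      rw [F.app_tr, M.tr_smul] }

section Kaehler

variable {A : TambaraFunctor.{u, w} D} {B : TambaraFunctor.{u, w'} D} (φ : Hom A B)

/-- The `B`-module `Ω_{A|B} = I / I^{>1}` of Kähler differentials of `φ : A → B`, where `I` is the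
kernel of `μ : B ⊠_A B → B` and `B` acts through `b ↦ b ⊗ 1`. -/
def kaehler : Mod.{u, w', max (u + 1) w'} B :=
  ((relBoxMul φ).ker.quotient (relBoxMul φ).ker.gtOne).restrictScalars (relBoxInl φ)

/-- The universal derivation `δ : B → Ω_{A|B}`, `b ↦ 1 ⊗ b - b ⊗ 1`. -/
def kaehlerD {X : FinGSet G} (b : B.obj X) : (kaehler φ).obj X :=
  Submodule.Quotient.mk (p := (relBoxMul φ).ker.inter (relBoxMul φ).ker.gtOne X)
    ⟨(relBoxInr φ).app X b - (relBoxInl φ).app X b, by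
      refine (RingHom.mem_ker).2 ?_
      rw [map_sub]
      change 1 * b - b * 1 = 0
      rw [one_mul, mul_one, sub_self]⟩

end Kaehler

/-! ## Several generators -/

/-- The box product `A^𝒪[x_{Z 0}] ⊠ (A^𝒪[x_{Z 1}] ⊠ (⋯ ⊠ A))` of finitely many free functors; the
empty box product is the unit, the Burnside functor `A = P_𝒪(∅, -)`. -/
def freeBox (D : IndexingCategory G) : ∀ (n : ℕ), (Fin n → FinGSet G) → TambaraFunctor.{u, u + 1} D
  | 0, _ => free D FinGSet.empty
  | n + 1, Z => box.{u, u + 1, u + 1} (free D (Z 0)) (freeBox D n fun i => Z i.succ)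

/-- The generators `x_i = 1 ⊗ ⋯ ⊗ Id ⊗ ⋯ ⊗ 1`, with the identity polynomial of `Z i` in
position `i`. -/
def freeBoxGen (D : IndexingCategory G) : ∀ (n : ℕ) (Z : Fin n → FinGSet G) (i : Fin n),
    (freeBox D n Z).obj (Z i)
  | 0, _ => fun i => i.elim0
  | n + 1, Z => Fin.cases
      ((boxInl (free D (Z 0)) (freeBox D n fun i => Z i.succ)).app (Z 0) (freeId D (Z 0)))
      fun i => (boxInr (free D (Z 0)) (freeBox D n fun i => Z i.succ)).app (Z i.succ)
        (freeBoxGen D n (fun i => Z i.succ) i)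

/-- The element `1 ⊗ Id` of `(R ⊠ A^𝒪[x_Z])(Z)`. -/
def polyGen (R : TambaraFunctor.{u, w} D) (Z : FinGSet G) : (R.box (free D Z)).obj Z :=
  (R.boxInr (free D Z)).app Z (freeId D Z)

/-- The element `1 ⊗ x_i` of `(R ⊠ (A^𝒪[x_{Z 0}] ⊠ ⋯))(Z i)`. -/
def polyGens (R : TambaraFunctor.{u, w} D) (n : ℕ) (Z : Fin n → FinGSet G) (i : Fin n) :
    (R.box (freeBox D n Z)).obj (Z i) :=
  (R.boxInr (freeBox D n Z)).app (Z i) (freeBoxGen D n Z i)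

end TambaraFunctor

/-! A genuine derivation `d : S → M` is the same thing as a section `s ↦ (s, d s)` of the square
zero extension `S ⋉ M → S` in the category of `𝒪`-Tambara functors. The norm of `(s, m)` in `S ⋉ M`
is `(N_f s, T_f (N_{π₂} R_{π₁} s • m))`, so the defining formula for derivations is compatibility
with norms. Let `S = R ⊠ T` with `T` free on elements `t i`. A morphism `S → S ⋉ M` extending `r ↦
(r ⊗ 1, 0)` is an arbitrary choice of images of the `1 ⊗ t i`; it is a section exactly when these
images have the form `(1 ⊗ t i, m i)`. Hence derivations over `R` correspond to families `m i`
(`bijective_der_box`). The several-generator case is the same, since a coproduct of free functors is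
free (`isFreeOn_freeBox`).

The work is in showing that `S ⋉ M` is a Tambara functor (`sqZero`). It rests on rules for the
punctured norm `N_{π₂} R_{π₁}`: the factorisation of `R_f N_f s`, a chain rule, base change, and a
version of the Tambara relation (`puncturedNm_mul_self`, `puncturedNm_comp`, `res_puncturedNm`,
`res_puncturedNm_tr`).

The statements about `Ω` follow because `Ω` represents derivations, which has three ingredients.
First, `δ` is a derivation: modulo `I^{>1}` the norm has the first-order expansion `N_f (a + i) =
N_f a + T_f (N_{π₂} R_{π₁} a * i)`. This comes from the exponential diagram of the fold map, whose
sections over a fibre of `f` are the subsets of the fibre; subsets with 0, 1 and at least 2 elements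
give the three parts (`exists_nm_add`). Second, a derivation `d` induces a morphism `B ⊠_A B → B ⋉
M`, `b ⊗ b' ↦ (b, 0) (b', d b')`. It sends `I` into `0 ⊕ M` and kills `I^{>1}`, so it descends to
`Ω` (`Der.kaehlerLift`). Third, every element of a box product is a single transfer of some `m ⊗ n`,
so `Ω` is generated by the `δ b` and the descended map is unique (`exists_eq_tr_smul_kaehlerD`).
`kaehler_isBasis` combines these facts with the computation of derivations. -/

namespace FinGSet

/-! ### Finite `G`-sets: subobjects, fibre products, disjoint unions -/

variable {G : Type u} [Group G]

/-- The sub-`G`-set of a finite `G`-set cut out by an invariant predicate. -/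
def sub (X : FinGSet G) (p : X → Prop) (hp : ∀ (a : G) (x : X), p x → p (a • x)) : FinGSet G :=
  letI : MulAction G {x : X // p x} :=
    { smul := fun a x => ⟨a • x.1, hp a x.1 x.2⟩
      one_smul := fun x => Subtype.ext (one_smul G x.1)
      mul_smul := fun a b x => Subtype.ext (mul_smul a b x.1) }
  ⟨{x : X // p x}⟩

/-- The inclusion of a sub-`G`-set. -/
def subVal (X : FinGSet G) (p : X → Prop) (hp : ∀ (a : G) (x : X), p x → p (a • x)) :
    sub X p hp →[G] X where
  toFun x := x.1
  map_smul' _ _ := rfl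

/-- The product of two finite `G`-sets. -/
def prod (X Y : FinGSet G) : FinGSet G := ⟨X × Y⟩

def prodFst (X Y : FinGSet G) : prod X Y →[G] X where
  toFun x := x.1
  map_smul' _ _ := rfl

def prodSnd (X Y : FinGSet G) : prod X Y →[G] Y where
  toFun x := x.2
  map_smul' _ _ := rfl

/-- The fibre product of `f` and `g`. -/
def fiberProd {X Y Z : FinGSet G} (f : X →[G] Z) (g : Y →[G] Z) : FinGSet G :=
  sub (prod X Y) (fun q => f q.1 = g q.2) fun a q h => by
    change f (a • q.1) = g (a • q.2)
    rw [map_smul, map_smul, h]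

theorem isPullback_fiberProd {X Y Z : FinGSet G} (f : X →[G] Z) (g : Y →[G] Z) :
    IsPullback (P := fiberProd f g) ((prodFst X Y).comp (subVal _ _ _))
      ((prodSnd X Y).comp (subVal _ _ _)) f g :=
  ⟨fun q => q.2, fun x y h => ⟨⟨(x, y), h⟩, ⟨rfl, rfl⟩, fun _ hq =>
    Subtype.ext (Prod.ext hq.1 hq.2)⟩⟩

theorem isPullback_idHom {X Y : FinGSet G} (f : X →[G] Y) :
    IsPullback f (idHom X) (idHom Y) f :=
  ⟨fun _ => rfl, fun _ y h => ⟨y, ⟨h.symm, rfl⟩, fun _ hq => hq.2⟩⟩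

theorem isPullback_of_injective {X Y : FinGSet G} (f : X →[G] Y) (hf : Function.Injective f) :
    IsPullback (idHom X) (idHom X) f f :=
  ⟨fun _ => rfl, fun y _ h => ⟨y, ⟨rfl, hf h⟩, fun _ hq => hq.1⟩⟩

/-- The map from the empty `G`-set. -/
def fromEmpty (X : FinGSet G) : empty (G := G) →[G] X := ⟨fun z => z.elim, fun _ z => z.elim⟩

theorem isPullback_of_disjoint {X X' Y : FinGSet G} (f : X →[G] Y) (g : X' →[G] Y)
    (hfg : ∀ x x', f x ≠ g x') : IsPullback (fromEmpty X) (fromEmpty X') f g :=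
  ⟨fun z => z.elim, fun y y' h => absurd h (hfg y y')⟩

/-- The fibre product `X ×_Y X` is the disjoint union of the complement of the diagonal and `X`. -/
theorem isPullback_desc_offDiag {X Y : FinGSet G} (f : X →[G] Y) :
    IsPullback (desc (offDiagFst f) (idHom X)) (desc (offDiagSnd f) (idHom X)) f f := by
  classical
  refine ⟨?_, ?_⟩
  · rintro (q | q)
    · exact q.2.1
    · rfl
  · intro x y hxy
    by_cases h : x = y
    · refine ⟨Sum.inr x, ⟨rfl, h⟩, ?_⟩
      rintro (q | q) ⟨h1, h2⟩
      · exact absurd ((show q.1.1 = x from h1).trans (h.trans (show q.1.2 = y from h2).symm))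
          q.2.2
      · exact congrArg Sum.inr h1
    · refine ⟨Sum.inl ⟨(x, y), hxy, h⟩, ⟨rfl, rfl⟩, ?_⟩
      rintro (q | q) ⟨h1, h2⟩
      · exact congrArg Sum.inl (Subtype.ext (Prod.ext h1 h2))
      · exact absurd ((show q = x from h1).symm.trans (show q = y from h2)) h

/-- `X` is the disjoint union of `A` and `B` through the maps `i` and `j`. -/
def IsCoprod {A B X : FinGSet G} (i : A →[G] X) (j : B →[G] X) : Prop :=
  Function.Bijective (desc i j)

theorem IsCoprod.of_cases {A B X : FinGSet G} {i : A →[G] X} {j : B →[G] X}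
    (hi : Function.Injective i) (hj : Function.Injective j) (hij : ∀ a b, i a ≠ j b)
    (h : ∀ x, (∃ a, i a = x) ∨ ∃ b, j b = x) : IsCoprod i j := by
  refine ⟨?_, fun x => ?_⟩
  · rintro (a | a) (b | b) hab
    · exact congrArg Sum.inl (hi hab)
    · exact absurd hab (hij a b)
    · exact absurd hab.symm (hij b a)
    · exact congrArg Sum.inr (hj hab)
  · obtain ⟨a, ha⟩ | ⟨b, hb⟩ := h x
    · exact ⟨Sum.inl a, ha⟩
    · exact ⟨Sum.inr b, hb⟩

/-- The inverse of a bijective equivariant map. -/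
theorem exists_inverse {X Y : FinGSet G} (f : X →[G] Y) (hf : Function.Bijective f) :
    ∃ g : Y →[G] X, f.comp g = idHom Y ∧ g.comp f = idHom X := by
  obtain ⟨g, hl, hr⟩ := Function.bijective_iff_has_inverse.1 hf
  exact ⟨f.inverse g hl hr, DFunLike.ext _ _ hr, DFunLike.ext _ _ hl⟩

end FinGSet

/-! ### Norms and transfers over disjoint unions; the punctured norm -/

namespace TambaraFunctor

variable {G : Type u} [Group G] {D : IndexingCategory G}

section

variable (S : TambaraFunctor.{u, w} D)

theorem res_congr {X Y : FinGSet G} {f g : X →[G] Y} (h : f = g) (a : S.obj Y) :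
    S.res f a = S.res g a := by rw [h]

theorem nm_congr {X Y : FinGSet G} {f g : X →[G] Y} (h : f = g) (hf : D.adm f) (hg : D.adm g)
    (a : S.obj X) : S.nm f hf a = S.nm g hg a := by subst h; rfl

theorem res_injective_of_bijective {X Y : FinGSet G} (f : X →[G] Y) (hf : Function.Bijective f) :
    Function.Injective (S.res f) := by
  obtain ⟨g, hfg, -⟩ := exists_inverse f hf
  intro a b h
  rw [← S.res_id Y a, ← S.res_id Y b, ← hfg, S.res_comp, S.res_comp, h]

theorem tr_res_of_bijective {X Y : FinGSet G} (f : X →[G] Y) (hf : Function.Bijective f)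
    (a : S.obj Y) : S.tr f (S.res f a) = a :=
  S.res_injective_of_bijective f hf (S.res_tr_of_injective f hf.1 _)

theorem res_nm_of_injective {X Y : FinGSet G} (f : X →[G] Y) (h : D.adm f)
    (hf : Function.Injective f) (a : S.obj X) : S.res f (S.nm f h a) = a := by
  rw [S.res_nm _ _ f f (isPullback_of_injective f hf) h, S.nm_id, S.res_id]

theorem nm_res_of_bijective {X Y : FinGSet G} (f : X →[G] Y) (h : D.adm f)
    (hf : Function.Bijective f) (a : S.obj Y) : S.nm f h (S.res f a) = a :=
  S.res_injective_of_bijective f hf (S.res_nm_of_injective f h hf.1 _)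

theorem nm_of_isEmpty {X Y : FinGSet G} (f : X →[G] Y) (hf : D.adm f) (hX : IsEmpty X)
    (a : S.obj X) : S.nm f hf a = 1 := by
  have := S.subsingleton_of_isEmpty X hX
  rw [Subsingleton.elim a 1, map_one]

theorem res_nm_of_disjoint {X X' Y : FinGSet G} (f : X →[G] Y) (hf : D.adm f) (g : X' →[G] Y)
    (hfg : ∀ x x', f x ≠ g x') (a : S.obj X) : S.res g (S.nm f hf a) = 1 := by
  rw [S.res_nm _ _ f g (isPullback_of_disjoint f g hfg) hf]
  exact S.nm_of_isEmpty _ _ ⟨fun z => PEmpty.elim z⟩ _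

/-- Multiplicative counterpart of `coprod_decomp`: a norm along one inclusion restricts to `1` on
the other summand, since the norm along a map from the empty set is `1`. -/
theorem nm_inl_mul_nm_inr {X Y : FinGSet G} (a : S.obj (coprod X Y)) :
    S.nm (inl X Y) (D.adm_inl X Y) (S.res (inl X Y) a) *
      S.nm (inr X Y) (D.adm_inr X Y) (S.res (inr X Y) a) = a := by
  refine (S.coprod_bijective X Y).1 (Prod.ext ?_ ?_)
  · change S.res (inl X Y) (_ * _) = S.res (inl X Y) a
    rw [map_mul, S.res_nm_of_injective _ _ Sum.inl_injective,
      S.res_nm_of_disjoint _ _ _ (fun _ _ => Sum.inr_ne_inl), mul_one]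
  · change S.res (inr X Y) (_ * _) = S.res (inr X Y) a
    rw [map_mul, S.res_nm_of_injective _ _ Sum.inr_injective,
      S.res_nm_of_disjoint _ _ _ (fun _ _ => Sum.inl_ne_inr), one_mul]

theorem nm_desc {X Y Z : FinGSet G} (f : X →[G] Z) (g : Y →[G] Z) (hf : D.adm f) (hg : D.adm g)
    (hfg : D.adm (desc f g)) (a : S.obj (coprod X Y)) :
    S.nm (desc f g) hfg a = S.nm f hf (S.res (inl X Y) a) * S.nm g hg (S.res (inr X Y) a) := by
  conv_lhs => rw [← S.nm_inl_mul_nm_inr a]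
  rw [map_mul, ← S.nm_comp, ← S.nm_comp]
  rfl

theorem tr_desc {X Y Z : FinGSet G} (f : X →[G] Z) (g : Y →[G] Z) (a : S.obj (coprod X Y)) :
    S.tr (desc f g) a = S.tr f (S.res (inl X Y) a) + S.tr g (S.res (inr X Y) a) := by
  conv_lhs => rw [S.coprod_decomp a]
  rw [map_add, ← S.tr_comp, ← S.tr_comp]
  rfl

/-- The norm along a map out of a disjoint union is the product of the norms. -/
theorem nm_of_isCoprod {A B X Y : FinGSet G} {i : A →[G] X} {j : B →[G] X} (h : IsCoprod i j)
    (f : X →[G] Y) (hf : D.adm f) (hi : D.adm (f.comp i)) (hj : D.adm (f.comp j)) (a : S.obj X) :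
    S.nm f hf a = S.nm (f.comp i) hi (S.res i a) * S.nm (f.comp j) hj (S.res j a) := by
  have hd : D.adm (desc i j) := D.adm_of_bijective _ h
  conv_lhs => rw [← S.nm_res_of_bijective _ hd h a]
  rw [← S.nm_comp, S.nm_congr (show f.comp (desc i j) = desc (f.comp i) (f.comp j) from
    DFunLike.ext _ _ (by rintro (x | x) <;> rfl)) _ (D.adm_desc _ _ hi hj), S.nm_desc _ _ hi hj,
    ← S.res_comp, ← S.res_comp]
  rfl

/-- The transfer along a map out of a disjoint union is the sum of the transfers. -/
theorem tr_of_isCoprod {A B X Y : FinGSet G} {i : A →[G] X} {j : B →[G] X} (h : IsCoprod i j)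
    (f : X →[G] Y) (a : S.obj X) :
    S.tr f a = S.tr (f.comp i) (S.res i a) + S.tr (f.comp j) (S.res j a) := by
  conv_lhs => rw [← S.tr_res_of_bijective _ h a]
  rw [← S.tr_comp, show f.comp (desc i j) = desc (f.comp i) (f.comp j) from
    DFunLike.ext _ _ (by rintro (x | x) <;> rfl), S.tr_desc, ← S.res_comp, ← S.res_comp]
  rfl

/-- The element of `S(X ⊔ Y)` with given restrictions. -/
theorem exists_res_inl_res_inr {X Y : FinGSet G} (a : S.obj X) (b : S.obj Y) :
    ∃ c : S.obj (coprod X Y), S.res (inl X Y) c = a ∧ S.res (inr X Y) c = b := by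
  obtain ⟨c, hc⟩ := (S.coprod_bijective X Y).2 (a, b)
  exact ⟨c, congrArg Prod.fst hc, congrArg Prod.snd hc⟩

/-- The norm of zero along a surjective map vanishes. -/
theorem nm_zero {X Y : FinGSet G} (f : X →[G] Y) (hf : D.adm f) (hs : Function.Surjective f) :
    S.nm f hf 0 = 0 := by
  -- Zero is a transfer from the empty set. Since the fibres of `f` are nonempty, `∅ → X` has no
  -- section over any of them, so the set of sections in the exponential diagram is again empty.
  have he : IsExponential (fromEmpty X) f (idHom empty) (idHom empty) (fromEmpty Y) := by
    refine ⟨⟨fun z => z.elim, fun _ z => z.elim⟩, fun y s _ => ?_⟩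
    obtain ⟨x, hx⟩ := hs y
    exact (s ⟨x, hx⟩).elim
  have := S.nm_tr _ _ _ _ _ he hf 0
  have h0 := S.subsingleton_of_isEmpty empty ⟨fun z => z.elim⟩
  rw [map_zero] at this
  rw [this, Subsingleton.elim (S.nm (idHom empty) _ _) 0, map_zero]

/-- The product of the conjugates of `s` over the other points of the fibres of `f`. -/
def puncturedNm {X Y : FinGSet G} (f : X →[G] Y) (hf : D.adm f) : S.obj X →* S.obj X :=
  (S.nm (offDiagSnd f) (D.adm_offDiagSnd f hf)).comp (S.res (offDiagFst f)).toMonoidHom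

theorem puncturedNm_apply {X Y : FinGSet G} (f : X →[G] Y) (hf : D.adm f) (s : S.obj X) :
    S.puncturedNm f hf s =
      S.nm (offDiagSnd f) (D.adm_offDiagSnd f hf) (S.res (offDiagFst f) s) := rfl

/-- Double coset formula for `X ×_Y X`: the diagonal contributes the factor `s`, its complement the
punctured norm. The punctured norm thus plays the role of `N_f s / s`. -/
theorem puncturedNm_mul_self {X Y : FinGSet G} (f : X →[G] Y) (hf : D.adm f) (s : S.obj X) :
    S.puncturedNm f hf s * s = S.res f (S.nm f hf s) := by
  rw [S.res_nm _ _ f f (isPullback_desc_offDiag f) hf,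
    S.nm_desc _ _ (D.adm_offDiagSnd f hf) (D.adm_id X), S.nm_id, ← S.res_comp, ← S.res_comp]
  exact congrArg (S.puncturedNm f hf s * ·) (S.res_id X s).symm

theorem puncturedNm_idHom (X : FinGSet G) (s : S.obj X) :
    S.puncturedNm (idHom X) (D.adm_id X) s = 1 :=
  S.nm_of_isEmpty _ _ ⟨fun (q : offDiag (idHom X)) => q.2.2 q.2.1⟩ _

/-- Every point of `X` has another point in its fibre, so `π₂` is surjective and the norm of zero
along it vanishes. This is why derivations do not see `I^{>1}`. -/
theorem puncturedNm_zero {X Y : FinGSet G} (f : X →[G] Y) (hf : D.adm f) (h : TwoSurjective f) :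
    S.puncturedNm f hf 0 = 0 := by
  rw [puncturedNm_apply, map_zero]
  refine S.nm_zero _ _ fun x => ?_
  obtain ⟨x₁, x₂, hne, h1, h2⟩ := h (f x)
  by_cases hx : x₁ = x
  · exact ⟨⟨(x₂, x), h2, fun h' => hne (hx.trans h'.symm)⟩, rfl⟩
  · exact ⟨⟨(x₁, x), h1, hx⟩, rfl⟩

/-- Chain rule. The points other than `x` in the fibre of `g ∘ f` through `x` either lie over a
point of `Y` other than `f x`, which gives the first factor, or lie over `f x` itself, which gives
the second. -/
theorem puncturedNm_comp {X Y Z : FinGSet G} (g : Y →[G] Z) (f : X →[G] Y) (hg : D.adm g)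
    (hf : D.adm f) (s : S.obj X) :
    S.puncturedNm (g.comp f) (D.adm_comp g f hg hf) s =
      S.res f (S.puncturedNm g hg (S.nm f hf s)) * S.puncturedNm f hf s := by
  -- pairs of points of `X` in the same fibre of `g.comp f`, but in different fibres of `f`
  let E : FinGSet G := sub (offDiag (g.comp f)) (fun q => f q.1.1 ≠ f q.1.2) fun a q h h' => by
    change f (a • q.1.1) = f (a • q.1.2) at h'
    rw [map_smul, map_smul] at h'
    exact h (MulAction.injective a h')
  let j : E →[G] offDiag (g.comp f) := subVal _ _ _
  let i : offDiag f →[G] offDiag (g.comp f) :=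
    { toFun := fun q => ⟨q.1, congrArg g q.2.1, q.2.2⟩
      map_smul' := fun _ _ => rfl }
  have hij : IsCoprod j i := by
    refine .of_cases Subtype.val_injective (fun q q' h => Subtype.ext (congrArg (·.1) h)) ?_ ?_
    · rintro q q' h
      exact q.2 (by rw [show q.1 = i q' from h]; exact q'.2.1)
    · intro q
      by_cases h : f q.1.1 = f q.1.2
      · exact Or.inr ⟨⟨q.1, h, q.2.2⟩, rfl⟩
      · exact Or.inl ⟨⟨q, h⟩, rfl⟩
  have hp := isPullback_fiberProd f (offDiagFst g)
  let k : E →[G] fiberProd f (offDiagFst g) :=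
    { toFun := fun q => ⟨(q.1.1.1, ⟨(f q.1.1.1, f q.1.1.2), q.1.2.1, q.2⟩), rfl⟩
      map_smul' := fun a q => Subtype.ext (Prod.ext rfl (Subtype.ext (Prod.ext
        (map_smul f a q.1.1.1) (map_smul f a q.1.1.2)))) }
  -- A pair `(x, x')` in `E` is a point `x` over the first entry of an off-diagonal pair of `Y`,
  -- together with a point `x'` over its second entry. So the norm from `E` to `X` computes `R_f` of
  -- the punctured norm of `N_f s`.
  have hk : IsPullback k ((offDiagSnd (g.comp f)).comp j)
      ((offDiagSnd g).comp ((prodSnd X (offDiag g)).comp (subVal _ _ _))) f := by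
    refine ⟨fun _ => rfl, ?_⟩
    rintro ⟨⟨x, ⟨⟨y, y'⟩, hy, hne⟩⟩, hx⟩ x' h
    have hx' : f x = y := hx
    have h' : y' = f x' := h
    subst hx' h'
    refine ⟨⟨⟨(x, x'), hy, fun h => hne (congrArg f h)⟩, hne⟩, ⟨rfl, rfl⟩, ?_⟩
    rintro q ⟨h1, h2⟩
    exact Subtype.ext (Subtype.ext (Prod.ext (congrArg (fun z => z.1.1) h1) h2))
  rw [puncturedNm_apply, puncturedNm_apply, puncturedNm_apply, S.res_nm _ _ _ _ hp hf,
    ← S.nm_comp, S.res_nm _ _ _ _ hk, ← S.res_comp,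
    S.nm_of_isCoprod hij _ _ (D.adm_pullback _ _ _ _ hk (D.adm_comp _ _ (D.adm_offDiagSnd g hg)
      (D.adm_pullback _ _ _ _ hp hf))) (D.adm_offDiagSnd f hf), ← S.res_comp, ← S.res_comp]
  rfl

/-- The complement of the diagonal commutes with base change: a pullback square identifies each
fibre of `f'` with a fibre of `f`, hence also the fibres with one point removed. -/
theorem res_puncturedNm {P X Y' Y : FinGSet G} (g' : P →[G] X) (f' : P →[G] Y') (f : X →[G] Y)
    (g : Y' →[G] Y) (hp : IsPullback g' f' f g) (hf : D.adm f) (s : S.obj X) :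
    S.res g' (S.puncturedNm f hf s) =
      S.puncturedNm f' (D.adm_pullback g' f' f g hp hf) (S.res g' s) := by
  have inj : ∀ q q', g' q = g' q' → f' q = f' q' → q = q' := fun q q' h1 h2 =>
    (hp.2 (g' q') (f' q') (hp.1 q')).unique ⟨h1, h2⟩ ⟨rfl, rfl⟩
  let k : offDiag f' →[G] offDiag f :=
    { toFun := fun q => ⟨(g' q.1.1, g' q.1.2), by rw [hp.1, hp.1, q.2.1],
        fun h => q.2.2 (inj _ _ h q.2.1)⟩
      map_smul' := fun a q => Subtype.ext (Prod.ext (map_smul g' a q.1.1) (map_smul g' a q.1.2)) }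
  have hk : IsPullback k (offDiagSnd f') (offDiagSnd f) g' := by
    refine ⟨fun _ => rfl, ?_⟩
    rintro ⟨⟨x, x'⟩, hx, hne⟩ q h
    have h' : x' = g' q := h
    subst h'
    obtain ⟨q', ⟨h1, h2⟩, -⟩ := hp.2 x (f' q) (hx.trans (hp.1 q))
    refine ⟨⟨(q', q), h2, fun h => hne (h1.symm.trans (congrArg g' h))⟩, ⟨Subtype.ext (Prod.ext h1 rfl), rfl⟩, ?_⟩
    rintro r ⟨h3, h4⟩
    have h4' : r.1.2 = q := h4
    refine Subtype.ext (Prod.ext (inj _ _ ((congrArg (fun z => z.1.1) h3).trans h1.symm) ?_) h4)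
    change f' r.1.1 = f' q'
    rw [r.2.1, h2, h4']
  rw [puncturedNm_apply, puncturedNm_apply, S.res_nm _ _ _ _ hk, ← S.res_comp, ← S.res_comp]
  rfl

/-- A point of `Q` over `a` is a section of `h` over the fibre of `g` through `h a` that takes the
value `a` at `h a`. Equivalently, it is an arbitrary section over that fibre with `h a` removed.
Hence `Q`, with `e : Q → A`, is the set of sections in an exponential diagram for the punctured
fibres, and the Tambara relation for that diagram gives the formula. -/
theorem res_puncturedNm_tr {X Y A Q P : FinGSet G} (h : A →[G] X) (g : X →[G] Y) (e : Q →[G] A)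
    (g' : Q →[G] P) (h' : P →[G] Y) (he : IsExponential h g e g' h') (hg : D.adm g) (s : S.obj A) :
    S.res h (S.puncturedNm g hg (S.tr h s)) =
      S.tr e (S.puncturedNm g' (D.adm_pullback _ g' g h' he.1 hg) (S.res e s)) := by
  classical
  have inj : ∀ q q', h (e q) = h (e q') → g' q = g' q' → q = q' := fun q q' h1 h2 =>
    (he.1.2 (h (e q')) (g' q') (he.1.1 q')).unique ⟨h1, h2⟩ ⟨rfl, rfl⟩
  have hp := isPullback_fiberProd (offDiagSnd g) h
  have hge : ∀ q, g (h (e q)) = h' (g' q) := he.1.1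
  let E₁ := fiberProd (offDiagSnd g) h
  let v : E₁ →[G] X := (offDiagFst g).comp ((prodFst _ _).comp (subVal _ _ _))
  let p : E₁ →[G] A := (prodSnd _ _).comp (subVal _ _ _)
  have hq := isPullback_fiberProd h v
  let E₂ := fiberProd h v
  have hp_ext : ∀ z z' : E₁, v z = v z' → p z = p z' → z = z' := fun z z' h1 h2 =>
    Subtype.ext (Prod.ext (Subtype.ext (Prod.ext h1 (by
      have h1' := z.2
      have h2' := z'.2
      have h3 : h z.1.2 = h z'.1.2 := congrArg h h2
      exact (h1'.trans h3).trans h2'.symm))) h2)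
  let e₁ : offDiag g' →[G] E₂ :=
    { toFun := fun q => ⟨(e q.1.1, ⟨(⟨(h (e q.1.1), h (e q.1.2)), (he.1.1 _).trans
          ((congrArg h' q.2.1).trans (he.1.1 _).symm), fun hh => q.2.2 (inj _ _ hh q.2.1)⟩,
          e q.1.2), rfl⟩), rfl⟩
      map_smul' := fun a q => by
        refine Subtype.ext (Prod.ext (map_smul e a q.1.1) (hp_ext _ _ ?_ (map_smul e a q.1.2)))
        exact (congrArg h (map_smul e a q.1.1)).trans (map_smul h a (e q.1.1)) }
  have hexp : IsExponential (X := E₁) (A := E₂) ((prodSnd A E₁).comp (subVal _ _ _)) p e₁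
      (offDiagSnd g') e := by
    refine ⟨⟨fun _ => rfl, ?_⟩, ?_⟩
    · intro z q hz
      have hz' : p z = e q := hz
      have hzz : h' (g' q) = g (v z) := by
        rw [← hge, ← hz']
        exact (z.1.1.2.1.trans (congrArg g z.2)).symm
      obtain ⟨q', ⟨h1, h2⟩, -⟩ := he.1.2 (v z) (g' q) hzz.symm
      refine ⟨⟨(q', q), h2, fun hh => z.1.1.2.2 ?_⟩, ⟨hp_ext _ _ h1 hz'.symm, rfl⟩, ?_⟩
      · exact h1.symm.trans ((congrArg (fun q => h (e q)) hh).trans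
          ((congrArg h hz').symm.trans z.2.symm))
      · rintro r ⟨h3, h4⟩
        have h4' : r.1.2 = q := h4
        refine Subtype.ext (Prod.ext (inj _ _ ((congrArg v h3).trans h1.symm) ?_) h4)
        change g' r.1.1 = g' q'
        rw [r.2.1, h2, h4']
    · intro a s hs
      let mkE : ∀ x : {x // g x = g (h a)}, x.1 ≠ h a → {z : E₁ // p z = a} := fun x hx =>
        ⟨⟨(⟨(x.1, h a), x.2, hx⟩, a), rfl⟩, rfl⟩
      -- The section `s` over the punctured fibre is completed by the value `a` at `h a`. The
      -- completed section is a point `r` of `P`, and the required point of `Q` is the one over `h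
      -- a` and `r`.
      let t : {x // g x = g (h a)} → A := fun x =>
        if hx : x.1 = h a then a else (s (mkE x hx)).1.1
      have ht : ∀ x, h (t x) = x.1 := by
        intro x
        by_cases hx : x.1 = h a
        · simp only [t, dif_pos hx, hx]
        · simp only [t, dif_neg hx]
          exact (s (mkE x hx)).2.trans (congrArg v (hs (mkE x hx)))
      obtain ⟨r, ⟨hr, hrt⟩, huniq⟩ := he.2 (g (h a)) t ht
      obtain ⟨q, ⟨hq1, hq2⟩, -⟩ := he.1.2 (h a) r hr.symm
      have hqa : e q = a := by
        rw [hrt q ⟨h a, rfl⟩ hq2 hq1]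
        simp only [t, dif_pos]
      refine ⟨q, ⟨hqa, ?_⟩, ?_⟩
      · rintro ⟨⟨q₁, q₂⟩, h1, hne⟩ ⟨z, hz⟩ h2 h3
        have h2' : q₂ = q := h2
        subst h2'
        have h1' : g' q₁ = r := h1.trans hq2
        have hvz : h (e q₁) = v z := congrArg v h3
        have hgz : g (v z) = g (h a) := by
          rw [← hvz, hge, h1', hr]
        have hza : v z ≠ h a := by
          rw [← hvz, ← hq1]
          exact fun hh => hne (inj _ _ hh h1)
        have hmk : mkE ⟨v z, hgz⟩ hza = ⟨z, hz⟩ := Subtype.ext (hp_ext _ _ rfl hz.symm)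
        have h5 : e q₁ = (s ⟨z, hz⟩).1.1 := by
          rw [hrt q₁ ⟨v z, hgz⟩ h1' hvz, ← hmk]
          simp only [t, dif_neg hza]
        exact Subtype.ext (Prod.ext h5 (h3.trans (hs ⟨z, hz⟩).symm))
      · rintro q' ⟨hq'a, hq's⟩
        refine inj _ _ (by rw [hq'a, hqa]) (hq2.symm ▸ huniq _ ⟨?_, ?_⟩)
        · rw [← hq'a, hge]
        · rintro q₁ x h1 h2
          by_cases hx : x.1 = h a
          · simp only [t, dif_pos hx]
            rw [inj q₁ q' (by rw [h2, hx, hq'a]) h1, hq'a]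
          · simp only [t, dif_neg hx]
            have hne : q₁ ≠ q' := fun hh => hx (by rw [← h2, hh, hq'a])
            have := hq's ⟨(q₁, q'), h1, hne⟩ (mkE x hx) rfl (hp_ext _ _ h2 hq'a)
            exact congrArg (fun z => z.1.1) this
  rw [puncturedNm_apply, puncturedNm_apply, S.res_nm _ _ _ _ hp, ← S.res_comp, S.res_tr _ _ _ _ hq,
    S.nm_tr _ _ _ _ _ hexp, ← S.res_comp, ← S.res_comp]
  rfl

end

end TambaraFunctor

/-! ### The square zero extension -/

namespace TambaraFunctor

variable {G : Type u} [Group G] {D : IndexingCategory G}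

section SquareZero

variable {S : TambaraFunctor.{u, w} D} (M : Mod.{u, w, w'} S)

/-- The value at `X` of the square zero extension `S ⋉ M`. -/
def SqZeroObj (X : FinGSet G) : Type (max w w') := S.obj X × M.obj X

instance (X : FinGSet G) : AddCommGroup (SqZeroObj M X) :=
  inferInstanceAs (AddCommGroup (S.obj X × M.obj X))

instance (X : FinGSet G) : Mul (SqZeroObj M X) :=
  ⟨fun a b => (a.1 * b.1, a.1 • b.2 + b.1 • a.2)⟩

instance (X : FinGSet G) : One (SqZeroObj M X) := ⟨(1, 0)⟩

theorem SqZeroObj.mul_comm' {X : FinGSet G} (a b : SqZeroObj M X) : a * b = b * a :=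
  Prod.ext (mul_comm _ _) (add_comm _ _)

theorem SqZeroObj.one_mul' {X : FinGSet G} (a : SqZeroObj M X) : 1 * a = a := by
  refine Prod.ext (one_mul _) ?_
  change (1 : S.obj X) • a.2 + a.1 • (0 : M.obj X) = a.2
  rw [one_smul, smul_zero, add_zero]

theorem SqZeroObj.mul_add' {X : FinGSet G} (a b c : SqZeroObj M X) :
    a * (b + c) = a * b + a * c := by
  refine Prod.ext (mul_add _ _ _) ?_
  change a.1 • (b.2 + c.2) + (b.1 + c.1) • a.2 =
    (a.1 • b.2 + b.1 • a.2) + (a.1 • c.2 + c.1 • a.2)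
  rw [smul_add, add_smul]
  abel

theorem SqZeroObj.mul_assoc' {X : FinGSet G} (a b c : SqZeroObj M X) :
    a * b * c = a * (b * c) := by
  refine Prod.ext (mul_assoc _ _ _) ?_
  change (a.1 * b.1) • c.2 + c.1 • (a.1 • b.2 + b.1 • a.2) =
    a.1 • (b.1 • c.2 + c.1 • b.2) + (b.1 * c.1) • a.2
  rw [smul_add, smul_add, smul_smul, smul_smul, smul_smul, smul_smul, mul_comm c.1 a.1,
    mul_comm c.1 b.1, add_assoc]

instance (X : FinGSet G) : CommRing (SqZeroObj M X) :=
  { (inferInstance : AddCommGroup (SqZeroObj M X)) with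
    mul := (· * ·)
    one := 1
    mul_assoc := SqZeroObj.mul_assoc' M
    mul_comm := SqZeroObj.mul_comm' M
    one_mul := SqZeroObj.one_mul' M
    mul_one := fun a => (SqZeroObj.mul_comm' M a 1).trans (SqZeroObj.one_mul' M a)
    left_distrib := SqZeroObj.mul_add' M
    right_distrib := fun a b c => by
      rw [SqZeroObj.mul_comm' M _ c, SqZeroObj.mul_add', SqZeroObj.mul_comm' M c,
        SqZeroObj.mul_comm' M c]
    zero_mul := fun a => Prod.ext (zero_mul _) (by
      change (0 : S.obj X) • a.2 + a.1 • (0 : M.obj X) = 0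
      rw [zero_smul, smul_zero, add_zero])
    mul_zero := fun a => Prod.ext (mul_zero _) (by
      change a.1 • (0 : M.obj X) + (0 : S.obj X) • a.2 = 0
      rw [zero_smul, smul_zero, add_zero]) }

/-- The square zero extension `S ⋉ M` of `S` by an `S`-module `M`, with the norms
`N_f (s, m) = (N_f s, T_f (N_{π₂} R_{π₁} s • m))`. -/
def sqZero : TambaraFunctor.{u, max w w'} D where
  obj := SqZeroObj M
  res f := RingHom.mk'
    { toFun := fun a => (S.res f a.1, M.res f a.2)
      map_one' := Prod.ext (map_one _) (map_zero _)
      map_mul' := fun a b => by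
        refine Prod.ext (map_mul _ _ _) ?_
        change M.res f (a.1 • b.2 + b.1 • a.2) = _
        rw [map_add, M.res_smul, M.res_smul]
        rfl }
    fun _ _ => Prod.ext (map_add _ _ _) (map_add _ _ _)
  tr f := AddMonoidHom.mk' (fun a => (S.tr f a.1, M.tr f a.2))
    fun _ _ => Prod.ext (map_add _ _ _) (map_add _ _ _)
  nm f hf :=
    { toFun := fun a => (S.nm f hf a.1, M.tr f (S.puncturedNm f hf a.1 • a.2))
      map_one' := Prod.ext (map_one _) (by
        change M.tr f (_ • (0 : M.obj _)) = 0
        rw [smul_zero, map_zero])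
      map_mul' := fun a b => by
        refine Prod.ext (map_mul _ _ _) ?_
        change M.tr f (S.puncturedNm f hf (a.1 * b.1) • (a.1 • b.2 + b.1 • a.2)) =
          S.nm f hf a.1 • M.tr f (S.puncturedNm f hf b.1 • b.2) +
            S.nm f hf b.1 • M.tr f (S.puncturedNm f hf a.1 • a.2)
        -- Frobenius reciprocity moves the norm under the transfer, where `R_f N_f s` splits off the
        -- factor `s`.
        rw [M.smul_tr, M.smul_tr, ← map_add, ← S.puncturedNm_mul_self, ← S.puncturedNm_mul_self,
          map_mul, smul_add, smul_smul, smul_smul, smul_smul, smul_smul, mul_right_comm,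
          mul_right_comm (S.puncturedNm f hf b.1), mul_comm (S.puncturedNm f hf b.1),
          mul_assoc _ _ b.1] }
  res_id X a := Prod.ext (S.res_id X _) (M.res_id X _)
  res_comp g f a := Prod.ext (S.res_comp g f _) (M.res_comp g f _)
  tr_id X a := Prod.ext (S.tr_id X _) (M.tr_id X _)
  tr_comp g f a := Prod.ext (S.tr_comp g f _) (M.tr_comp g f _)
  nm_id X a := Prod.ext (S.nm_id X _) (by
    change M.tr (idHom X) (S.puncturedNm _ _ a.1 • a.2) = a.2
    rw [S.puncturedNm_idHom, one_smul, M.tr_id])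
  nm_comp g f hg hf a := Prod.ext (S.nm_comp g f hg hf _) (by
    change M.tr (g.comp f) (S.puncturedNm _ _ a.1 • a.2) =
      M.tr g (S.puncturedNm g hg (S.nm f hf a.1) • M.tr f (S.puncturedNm f hf a.1 • a.2))
    rw [M.smul_tr, ← M.tr_comp, S.puncturedNm_comp, mul_smul])
  res_tr g' f' f g hp a := Prod.ext (S.res_tr g' f' f g hp _) (M.res_tr g' f' f g hp _)
  res_nm g' f' f g hp hf a := Prod.ext (S.res_nm g' f' f g hp hf _) (by
    change M.res g (M.tr f (S.puncturedNm f hf a.1 • a.2)) =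
      M.tr f' (S.puncturedNm f' _ (S.res g' a.1) • M.res g' a.2)
    rw [M.res_tr g' f' f g hp, M.res_smul, S.res_puncturedNm g' f' f g hp])
  tr_mul_res f a b := Prod.ext (S.tr_mul_res f _ _) (by
    change M.tr f (a.1 • M.res f b.2 + S.res f b.1 • a.2) = S.tr f a.1 • b.2 + b.1 • M.tr f a.2
    rw [map_add, M.tr_smul, M.smul_tr])
  nm_tr h g e g' h' he hg a := Prod.ext (S.nm_tr h g e g' h' he hg _) (by
    change M.tr g (S.puncturedNm g hg (S.tr h a.1) • M.tr h a.2) =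
      M.tr h' (M.tr g' (S.puncturedNm g' _ (S.res e a.1) • M.res e a.2))
    -- Frobenius reciprocity is used along `h` and then along `e`. Both sides become transfers of
    -- the same element, along `g ∘ h ∘ e` and `h' ∘ g'`, which agree by the commutative square of
    -- the exponential diagram.
    rw [M.smul_tr, S.res_puncturedNm_tr h g e g' h' he hg, M.tr_smul, ← M.tr_comp, ← M.tr_comp,
      ← M.tr_comp]
    congr 1
    exact congrArg M.tr (DFunLike.ext _ _ he.1.1))
  subsingleton_of_isEmpty X hX := by
    have h1 := S.subsingleton_of_isEmpty X hX
    have h2 := M.subsingleton_of_isEmpty X hX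
    exact ⟨fun a b => Prod.ext (Subsingleton.elim _ _) (Subsingleton.elim _ _)⟩
  coprod_bijective X Y := by
    refine ⟨fun a b h => ?_, fun ⟨a, b⟩ => ?_⟩
    · have h1 : (S.res (inl X Y) a.1, M.res (inl X Y) a.2) =
        (S.res (inl X Y) b.1, M.res (inl X Y) b.2) := congrArg Prod.fst h
      have h2 : (S.res (inr X Y) a.1, M.res (inr X Y) a.2) =
        (S.res (inr X Y) b.1, M.res (inr X Y) b.2) := congrArg Prod.snd h
      rw [Prod.ext_iff] at h1 h2
      exact Prod.ext ((S.coprod_bijective X Y).1 (Prod.ext h1.1 h2.1))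
        ((M.coprod_bijective X Y).1 (Prod.ext h1.2 h2.2))
    · obtain ⟨c, hc⟩ := (S.coprod_bijective X Y).2 (a.1, b.1)
      obtain ⟨d, hd⟩ := (M.coprod_bijective X Y).2 (a.2, b.2)
      rw [Prod.ext_iff] at hc hd
      exact ⟨(c, d), Prod.ext (Prod.ext hc.1 hd.1) (Prod.ext hc.2 hd.2)⟩

/-- The projection `S ⋉ M → S`. -/
def sqZeroFst : Hom (sqZero M) S where
  app _ := RingHom.mk' { toFun := fun a => a.1, map_one' := rfl, map_mul' := fun _ _ => rfl }
    fun _ _ => rfl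
  app_res _ _ := rfl
  app_tr _ _ := rfl
  app_nm _ _ _ := rfl

/-- The inclusion `S → S ⋉ M`, `s ↦ (s, 0)`. -/
def sqZeroInl : Hom S (sqZero M) where
  app X := RingHom.mk'
    { toFun := fun a => ((a, 0) : S.obj X × M.obj X)
      map_one' := rfl
      map_mul' := fun a b => Prod.ext rfl (by
        change 0 = a • (0 : M.obj X) + b • (0 : M.obj X)
        rw [smul_zero, smul_zero, add_zero]) }
    fun a b => Prod.ext rfl (add_zero (0 : M.obj X)).symm
  app_res f a := Prod.ext rfl (map_zero (M.res f)).symm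
  app_tr f a := Prod.ext rfl (map_zero (M.tr f)).symm
  app_nm f hf a := Prod.ext rfl (by
    change 0 = M.tr f (_ • (0 : M.obj _))
    rw [smul_zero, map_zero])

end SquareZero

theorem Hom.ext {R : TambaraFunctor.{u, w} D} {S : TambaraFunctor.{u, w'} D} {F F' : Hom R S}
    (h : ∀ X a, F.app X a = F'.app X a) : F = F' := by
  cases F; cases F'
  congr
  funext X
  exact RingHom.ext (h X)

/-- The composite of two morphisms. -/
def Hom.comp {R : TambaraFunctor.{u, w} D} {S : TambaraFunctor.{u, w'} D}
    {T : TambaraFunctor.{u, w''} D} (F' : Hom S T) (F : Hom R S) : Hom R T where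
  app X := (F'.app X).comp (F.app X)
  app_res f a := (congrArg _ (F.app_res f a)).trans (F'.app_res f _)
  app_tr f a := (congrArg _ (F.app_tr f a)).trans (F'.app_tr f _)
  app_nm f hf a := (congrArg _ (F.app_nm f hf a)).trans (F'.app_nm f hf _)

/-! ### Genuine derivations as sections of the square zero extension -/

section Derivations

variable {A : TambaraFunctor.{u, w} D} {S : TambaraFunctor.{u, w'} D} (φ : Hom A S)
  (M : Mod.{u, w', w''} S)

theorem Der.ext {d d' : Der φ M} (h : ∀ X a, d.1 X a = d'.1 X a) : d = d' :=
  Subtype.ext (funext fun X => AddMonoidHom.ext (h X))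

/-- The module statement is the second coordinate of additivity of transfers in `S ⋉ M`, applied to
`(0, m)`. -/
theorem Mod.tr_fold {X : FinGSet G} (m : M.obj (coprod X X)) :
    M.tr (desc (idHom X) (idHom X)) m = M.res (inl X X) m + M.res (inr X X) m := by
  have := congrArg Prod.snd ((sqZero M).tr_desc (idHom X) (idHom X)
    ((0, m) : S.obj (coprod X X) × M.obj (coprod X X)))
  refine this.trans ?_
  change M.tr (idHom X) (M.res (inl X X) m) + M.tr (idHom X) (M.res (inr X X) m) = _
  rw [M.tr_id, M.tr_id]

theorem nm_fold {X : FinGSet G} (h : D.adm (desc (idHom X) (idHom X)))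
    (c : S.obj (coprod X X)) :
    S.nm (desc (idHom X) (idHom X)) h c = S.res (inl X X) c * S.res (inr X X) c := by
  rw [S.nm_desc _ _ (D.adm_id X) (D.adm_id X), S.nm_id, S.nm_id]

/-- A fibre of the fold map consists of a point and its twin in the other copy, so over one copy the
punctured norm is the value on the other. -/
theorem res_inl_puncturedNm_fold {X : FinGSet G} (h : D.adm (desc (idHom X) (idHom X)))
    (c : S.obj (coprod X X)) :
    S.res (inl X X) (S.puncturedNm (desc (idHom X) (idHom X)) h c) = S.res (inr X X) c := by
  let k : X →[G] offDiag (desc (idHom X) (idHom X)) :=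
    { toFun := fun x => ⟨(Sum.inr x, Sum.inl x), rfl, Sum.inr_ne_inl⟩
      map_smul' := fun _ _ => rfl }
  have hk : IsPullback k (idHom X) (offDiagSnd (desc (idHom X) (idHom X))) (inl X X) := by
    refine ⟨fun _ => rfl, ?_⟩
    rintro ⟨⟨x | x, y⟩, hxy, hne⟩ z (rfl : y = Sum.inl z)
    · exact absurd (congrArg Sum.inl hxy) hne
    · have hxz : x = z := hxy
      subst hxz
      exact ⟨x, ⟨rfl, rfl⟩, fun _ hq => hq.2⟩
  rw [puncturedNm_apply, S.res_nm _ _ _ _ hk, S.nm_id, ← S.res_comp]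
  rfl

theorem res_inr_puncturedNm_fold {X : FinGSet G} (h : D.adm (desc (idHom X) (idHom X)))
    (c : S.obj (coprod X X)) :
    S.res (inr X X) (S.puncturedNm (desc (idHom X) (idHom X)) h c) = S.res (inl X X) c := by
  let k : X →[G] offDiag (desc (idHom X) (idHom X)) :=
    { toFun := fun x => ⟨(Sum.inl x, Sum.inr x), rfl, Sum.inl_ne_inr⟩
      map_smul' := fun _ _ => rfl }
  have hk : IsPullback k (idHom X) (offDiagSnd (desc (idHom X) (idHom X))) (inr X X) := by
    refine ⟨fun _ => rfl, ?_⟩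
    rintro ⟨⟨x | x, y⟩, hxy, hne⟩ z (rfl : y = Sum.inr z)
    · have hxz : x = z := hxy
      subst hxz
      exact ⟨x, ⟨rfl, rfl⟩, fun _ hq => hq.2⟩
    · exact absurd (congrArg Sum.inr hxy) hne
  rw [puncturedNm_apply, S.res_nm _ _ _ _ hk, S.nm_id, ← S.res_comp]
  rfl

/-- A genuine derivation satisfies the Leibniz rule: products are norms along fold maps. -/
theorem Der.leibniz (d : Der φ M) {X : FinGSet G} (a b : S.obj X) :
    d.1 X (a * b) = a • d.1 X b + b • d.1 X a := by
  obtain ⟨hres, -, -, hnm⟩ := d.2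
  -- With `a` and `b` glued to one element `c` over `X ⊔ X`, the product `a * b` is the norm of `c`
  -- along the fold map, and the norm rule for `d` applies.
  obtain ⟨c, rfl, rfl⟩ := S.exists_res_inl_res_inr a b
  have h := D.adm_desc _ _ (D.adm_id X) (D.adm_id X)
  have key := hnm _ h c
  rw [nm_fold h, ← puncturedNm_apply (hf := h), Mod.tr_fold, M.res_smul, M.res_smul, res_inl_puncturedNm_fold,
    res_inr_puncturedNm_fold, ← hres, ← hres] at key
  rw [key, add_comm]

theorem Der.map_one (d : Der φ M) (X : FinGSet G) : d.1 X 1 = 0 := by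
  have := Der.leibniz φ M d (1 : S.obj X) 1
  rwa [mul_one, one_smul, left_eq_add] at this

/-- The section `s ↦ (s, d s)` of `S ⋉ M → S` given by a genuine derivation. -/
def Der.toHom (d : Der φ M) : Hom S (sqZero M) where
  app X := RingHom.mk'
    { toFun := fun a => ((a, d.1 X a) : S.obj X × M.obj X)
      map_one' := Prod.ext rfl (Der.map_one φ M d X)
      map_mul' := fun a b => Prod.ext rfl (Der.leibniz φ M d a b) }
    fun a b => Prod.ext rfl (map_add (d.1 X) a b)
  app_res f a := Prod.ext rfl (d.2.1 f a)
  app_tr f a := Prod.ext rfl (d.2.2.1 f a)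
  app_nm f hf a := Prod.ext rfl (d.2.2.2.2 f hf a)

/-- The genuine derivation given by a section of `S ⋉ M → S` over `A`. -/
def Der.ofHom (F : Hom S (sqZero M)) (hF : ∀ X a, (F.app X a).1 = a)
    (hφ : ∀ X a, F.app X (φ.app X a) = (φ.app X a, 0)) : Der φ M where
  val X :=
    { toFun := fun a => (F.app X a).2
      map_zero' := congrArg Prod.snd (map_zero (F.app X))
      map_add' := fun a b => congrArg Prod.snd (map_add (F.app X) a b) }
  property := by
    refine ⟨fun f s => congrArg Prod.snd (F.app_res f s), fun f s => congrArg Prod.snd (F.app_tr f s),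
      fun X a => congrArg Prod.snd (hφ X a), fun f hf s => ?_⟩
    refine (congrArg Prod.snd (F.app_nm f hf s)).trans ?_
    change M.tr f (S.puncturedNm f hf (F.app _ s).1 • (F.app _ s).2) = _
    rw [hF]
    rfl

end Derivations

/-! ### Universal properties of free functors and box products -/

section Universal

variable {gen : FinGSet G → Type v} {rel : ∀ X : FinGSet G, Term D gen X → Term D gen X → Prop}

/-- Morphisms out of a presented functor are determined by their values on the generators. -/
theorem Presented.hom_ext {S : TambaraFunctor.{u, w} D} {F F' : Hom (Presented rel) S}
    (h : ∀ X (a : gen X), F.app X (Presented.mk rel (.of a)) = F'.app X (Presented.mk rel (.of a))) :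
    F = F' := by
  have key : ∀ {X : FinGSet G} (t : Term D gen X),
      F.app X (Presented.mk rel t) = F'.app X (Presented.mk rel t) := by
    intro X t
    induction t with
    | of a => exact h _ a
    | zero => exact (map_zero (F.app _)).trans (map_zero (F'.app _)).symm
    | one => exact (_root_.map_one (F.app _)).trans (_root_.map_one (F'.app _)).symm
    | add a b iha ihb =>
      exact (map_add (F.app _) (mk rel a) (mk rel b)).trans
        ((congrArg₂ _ iha ihb).trans
          (map_add (F'.app _) (mk rel a) (mk rel b)).symm)
    | mul a b iha ihb =>
      exact (map_mul (F.app _) (mk rel a) (mk rel b)).trans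
        ((congrArg₂ _ iha ihb).trans
          (map_mul (F'.app _) (mk rel a) (mk rel b)).symm)
    | neg a iha =>
      exact (map_neg (F.app _) (mk rel a)).trans
        ((congrArg _ iha).trans (map_neg (F'.app _) (mk rel a)).symm)
    | res f a iha =>
      exact (F.app_res f (mk rel a)).trans
        ((congrArg _ iha).trans (F'.app_res f (mk rel a)).symm)
    | tr f a iha =>
      exact (F.app_tr f (mk rel a)).trans
        ((congrArg _ iha).trans (F'.app_tr f (mk rel a)).symm)
    | nm f hf a iha =>
      exact (F.app_nm f hf (mk rel a)).trans
        ((congrArg _ iha).trans (F'.app_nm f hf (mk rel a)).symm)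
  exact Hom.ext fun X a => Presented.ind (rel := rel) (p := fun a => F.app X a = F'.app X a) key a

/-- The elements `t i ∈ T(Z i)` freely generate the `𝒪`-Tambara functor `T`. -/
def IsFreeOn (T : TambaraFunctor.{u, w} D) {ι : Type v} (Z : ι → FinGSet G)
    (t : ∀ i, T.obj (Z i)) : Prop :=
  ∀ (S : TambaraFunctor.{u, w'} D) (s : ∀ i, S.obj (Z i)),
    ∃! F : Hom T S, ∀ i, F.app (Z i) (t i) = s i

/-- The value of a polynomial at an element of `S(Z)`. -/
def evalBispan (S : TambaraFunctor.{u, w} D) {Z X : FinGSet G} (s : S.obj Z) (P : Bispan D Z X) :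
    S.obj X :=
  S.tr P.p (S.nm P.b P.adm (S.res P.c s))

/-- The two bijections form a pullback square, so the double coset formula transports the norm, and
the transfer along a bijection undoes the restriction along it. -/
theorem evalBispan_eq_of_iso (S : TambaraFunctor.{u, w} D) {Z X : FinGSet G} (s : S.obj Z)
    {P P' : Bispan D Z X} (h : P.Iso P') : S.evalBispan s P = S.evalBispan s P' := by
  obtain ⟨α, β, hα, hβ, h1, h2, h3⟩ := h
  have hp : IsPullback α P.b P'.b β := by
    refine ⟨h2, fun x y hxy => ?_⟩
    obtain ⟨q, rfl⟩ := hα.2 x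
    exact ⟨q, ⟨rfl, hβ.1 ((h2 q).symm.trans hxy)⟩, fun _ hq => hα.1 hq.1⟩
  have h1' : P.c = P'.c.comp α := DFunLike.ext _ _ fun a => (h1 a).symm
  have h3' : P.p = P'.p.comp β := DFunLike.ext _ _ fun a => (h3 a).symm
  rw [evalBispan, evalBispan, h1', h3', S.res_comp, S.tr_comp, ← S.res_nm _ _ _ _ hp P'.adm,
    S.tr_res_of_bijective β hβ]

/-- The morphism out of a free functor that takes the identity polynomial to `s`. -/
def freeLift (S : TambaraFunctor.{u, w} D) {Z : FinGSet G} (s : S.obj Z) : Hom (free D Z) S :=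
  Presented.lift S (fun _ => Quotient.lift (S.evalBispan s) fun _ _ h =>
    S.evalBispan_eq_of_iso s h) (by
    rintro X a b (⟨f, P, P', α, β, hb, hp, hc⟩ | ⟨f, P, P', rfl⟩ |
      ⟨f, hf, P, P', Q, e, g', α, b', he, hα, hc, hb⟩)
    · change S.res f (S.evalBispan s P) = S.evalBispan s P'
      rw [evalBispan, evalBispan, S.res_tr _ _ _ _ hp, S.res_nm _ _ _ _ hb, ← S.res_comp, hc]
    · exact (S.tr_comp f P.p _).symm
    · change S.nm f hf (S.evalBispan s P) = S.evalBispan s P'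
      have hg' : D.adm g' := D.adm_pullback _ _ _ _ he.1 hf
      have hb' : D.adm b' := D.adm_pullback _ _ _ _ hα P.adm
      rw [evalBispan, evalBispan, S.nm_tr _ _ _ _ _ he, S.res_nm _ _ _ _ hα, ← S.res_comp,
        S.nm_congr hb P'.adm (D.adm_comp _ _ hg' hb'), S.nm_comp _ _ hg' hb', hc])

theorem freeLift_freeId (S : TambaraFunctor.{u, w} D) {Z : FinGSet G} (s : S.obj Z) :
    (S.freeLift s).app Z (freeId D Z) = s := by
  change S.tr (idHom Z) (S.nm (idHom Z) _ (S.res (idHom Z) s)) = s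
  rw [S.tr_id, S.nm_id, S.res_id]

/-- Every polynomial is obtained from the identity polynomial by restriction, norm and transfer. -/
theorem mk_bispan {Z X : FinGSet G} (P : Bispan D Z X) :
    Presented.mk (PolyRel D Z) (.of (.mk P)) = (free D Z).evalBispan (freeId D Z) P := by
  have h1 : (free D Z).res P.c (freeId D Z) =
      Presented.mk (PolyRel D Z) (.of (.mk ⟨P.A, P.A, P.c, idHom _, idHom _, D.adm_id _⟩)) :=
    Presented.sound (.of (.res P.c _ _
      ⟨P.c, P.c, isPullback_idHom _, ⟨fun _ => rfl, fun x y h => ⟨y, ⟨h.symm, rfl⟩, fun _ hq => hq.2⟩⟩, rfl⟩))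
  -- The identity has exactly one section over each fibre of `P.b`, so the set of sections is `P.B`
  -- itself.
  have he : IsExponential (idHom P.A) P.b (idHom P.A) P.b (idHom P.B) :=
    ⟨⟨fun _ => rfl, fun x y h => ⟨x, ⟨rfl, h⟩, fun _ hq => hq.1⟩⟩, fun y s hs =>
      ⟨y, ⟨rfl, fun q x _ h => h.trans (hs x).symm⟩, fun _ hp => hp.1⟩⟩
  have h2 : (free D Z).nm P.b P.adm (Presented.mk (PolyRel D Z)
        (.of (.mk ⟨P.A, P.A, P.c, idHom _, idHom _, D.adm_id _⟩))) =
      Presented.mk (PolyRel D Z) (.of (.mk ⟨P.A, P.B, P.c, P.b, idHom _, P.adm⟩)) :=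
    Presented.sound (.of (.nm P.b P.adm _ _
      ⟨P.A, idHom _, P.b, idHom _, idHom _, he, isPullback_idHom _, rfl, rfl⟩))
  have h3 : (free D Z).tr P.p (Presented.mk (PolyRel D Z)
        (.of (.mk ⟨P.A, P.B, P.c, P.b, idHom _, P.adm⟩))) =
      Presented.mk (PolyRel D Z) (.of (.mk P)) :=
    Presented.sound (.of (.tr P.p _ _ rfl))
  rw [evalBispan, h1, h2, h3]

theorem Hom.app_evalBispan {R : TambaraFunctor.{u, w} D} {S : TambaraFunctor.{u, w'} D}
    (F : Hom R S) {Z X : FinGSet G} (s : R.obj Z) (P : Bispan D Z X) :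
    F.app X (R.evalBispan s P) = S.evalBispan (F.app Z s) P := by
  rw [evalBispan, F.app_tr, F.app_nm, F.app_res, evalBispan]

/-- Yoneda: every polynomial arises from the identity polynomial by restriction, norm and transfer,
so a morphism is determined by its value there, and `freeLift` realises every value. -/
theorem isFreeOn_free (D : IndexingCategory G) (Z : FinGSet G) :
    IsFreeOn.{u, v, u + 1, w'} (free D Z) (fun _ : PUnit.{v + 1} => Z) (fun _ => freeId D Z) := by
  intro S s
  refine ⟨S.freeLift (s ⟨⟩), fun _ => S.freeLift_freeId _, fun F hF => ?_⟩
  refine Presented.hom_ext fun X => ?_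
  rintro ⟨P⟩
  have h1 := congrArg (F.app X) (mk_bispan P)
  have h2 := congrArg ((S.freeLift (s ⟨⟩)).app X) (mk_bispan P)
  rw [F.app_evalBispan, hF ⟨⟩] at h1
  rw [Hom.app_evalBispan, S.freeLift_freeId] at h2
  exact h1.trans h2.symm

section Box

variable {R : TambaraFunctor.{u, w} D} {T : TambaraFunctor.{u, w'} D}
  {S : TambaraFunctor.{u, w''} D}

/-- Kept separate from the construction of `boxLift` because the relative box product has the same
relations among its own. -/
theorem eval_eq_of_boxRel (α : Hom R S) (β : Hom T S) {X : FinGSet G}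
    {a b : Term D (fun X => R.obj X × T.obj X) X} (h : BoxRel R T X a b) :
    Term.eval S (fun X p => α.app X p.1 * β.app X p.2) a =
      Term.eval S (fun X p => α.app X p.1 * β.app X p.2) b := by
  cases h with
  | add_tmul m m' n =>
    change α.app X (m + m') * _ = α.app X m * β.app X n + α.app X m' * β.app X n
    rw [map_add, add_mul]
  | tmul_add m n n' =>
    change _ * β.app X (n + n') = α.app X m * β.app X n + α.app X m * β.app X n'
    rw [map_add, mul_add]
  | tr_tmul f m n =>
    change α.app _ (R.tr f m) * β.app _ n = S.tr f (α.app _ m * β.app _ (T.res f n))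
    rw [α.app_tr, β.app_res, S.tr_mul_res]
  | tmul_tr f m n =>
    change α.app _ m * β.app _ (T.tr f n) = S.tr f (α.app _ (R.res f m) * β.app _ n)
    rw [β.app_tr, α.app_res, mul_comm, mul_comm (S.res f _), S.tr_mul_res]
  | res f m n =>
    change S.res f (α.app _ m * β.app _ n) = α.app _ (R.res f m) * β.app _ (T.res f n)
    rw [α.app_res, β.app_res, map_mul]
  | one =>
    change 1 = α.app X 1 * β.app X 1
    rw [map_one, map_one, mul_one]
  | mul m m' n n' =>
    change (α.app X m * β.app X n) * (α.app X m' * β.app X n') =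
      α.app X (m * m') * β.app X (n * n')
    rw [map_mul, map_mul, mul_mul_mul_comm]
  | nm f hf m n =>
    change S.nm f hf (α.app _ m * β.app _ n) = α.app _ (R.nm f hf m) * β.app _ (T.nm f hf n)
    rw [α.app_nm, β.app_nm, map_mul]

/-- In a functor with the relations of the box product, `m ⊗ n = (m ⊗ 1) (1 ⊗ n)`. -/
theorem mk_tmul (rel : ∀ X : FinGSet G, Term D (fun X => R.obj X × T.obj X) X →
      Term D (fun X => R.obj X × T.obj X) X → Prop)
    (h : ∀ X a b, BoxRel R T X a b → rel X a b) {X : FinGSet G} (m : R.obj X) (n : T.obj X) :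
    Presented.mk rel (tmul R T m n) =
      (tmulLeft rel h).app X m * (tmulRight rel h).app X n := by
  have := Presented.sound (.of (h _ _ _ (.mul m (1 : R.obj X) (1 : T.obj X) n)))
  rw [mul_one, one_mul] at this
  exact this.symm

/-- Since `m ⊗ n = (m ⊗ 1) (1 ⊗ n)`, the two inclusions determine a morphism. Allowing any relations
that contain those of the box product covers both `⊠` and `⊠_A`. -/
theorem tmul_hom_ext (rel : ∀ X : FinGSet G, Term D (fun X => R.obj X × T.obj X) X →
      Term D (fun X => R.obj X × T.obj X) X → Prop)
    (h : ∀ X a b, BoxRel R T X a b → rel X a b) {F F' : Hom (Presented rel) S}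
    (hl : F.comp (tmulLeft rel h) = F'.comp (tmulLeft rel h))
    (hr : F.comp (tmulRight rel h) = F'.comp (tmulRight rel h)) : F = F' := by
  refine Presented.hom_ext ?_
  rintro X ⟨m, n⟩
  have hl' : F.app X ((tmulLeft rel h).app X m) = F'.app X ((tmulLeft rel h).app X m) :=
    congrArg (fun H : Hom R S => H.app X m) hl
  have hr' : F.app X ((tmulRight rel h).app X n) = F'.app X ((tmulRight rel h).app X n) :=
    congrArg (fun H : Hom T S => H.app X n) hr
  have := mk_tmul rel h m n
  rw [tmul] at this
  rw [this, map_mul, map_mul, hl', hr']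

/-- The morphism `R ⊠ T → S` given by morphisms `R → S` and `T → S`. -/
def boxLift (α : Hom R S) (β : Hom T S) : Hom (box R T) S :=
  Presented.lift S (fun X p => α.app X p.1 * β.app X p.2) fun _ _ _ h => eval_eq_of_boxRel α β h

theorem boxLift_inl (α : Hom R S) (β : Hom T S) {X : FinGSet G} (r : R.obj X) :
    (boxLift α β).app X ((boxInl R T).app X r) = α.app X r := by
  change α.app X r * β.app X 1 = α.app X r
  rw [map_one, mul_one]

theorem boxLift_inr (α : Hom R S) (β : Hom T S) {X : FinGSet G} (t : T.obj X) :
    (boxLift α β).app X ((boxInr R T).app X t) = β.app X t := by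
  change α.app X 1 * β.app X t = β.app X t
  rw [map_one, one_mul]

/-- By induction, a coproduct of free functors is free on all the generators together. The base case
is the free functor on the empty `G`-set, which is initial because every functor has a unique
element there. -/
theorem isFreeOn_freeBox (D : IndexingCategory G) : ∀ (n : ℕ) (Z : Fin n → FinGSet G),
    IsFreeOn.{u, 0, u + 1, w'} (freeBox D n Z) Z (freeBoxGen D n Z)
  | 0, Z => by
    intro S s
    have := S.subsingleton_of_isEmpty empty ⟨fun z => z.elim⟩
    obtain ⟨F, -, hF⟩ := isFreeOn_free.{u, 0} D empty S (fun _ => 0)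
    exact ⟨F, fun i => i.elim0, fun F' _ => hF F' fun _ => Subsingleton.elim _ _⟩
  | n + 1, Z => by
    intro S s
    obtain ⟨α, hα, hα'⟩ := isFreeOn_free.{u, 0} D (Z 0) S (fun _ => s 0)
    obtain ⟨β, hβ, hβ'⟩ := isFreeOn_freeBox D n (fun i => Z i.succ) S (fun i => s i.succ)
    refine ⟨boxLift α β, fun i => ?_, fun F hF => ?_⟩
    · refine Fin.cases ?_ (fun i => ?_) i
      · exact (boxLift_inl α β _).trans (hα ⟨⟩)
      · exact (boxLift_inr α β _).trans (hβ i)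
    · refine tmul_hom_ext _ (fun _ _ _ h => h) ?_ ?_
      · refine (hα' _ fun _ => hF 0).trans (Hom.ext fun X a => (boxLift_inl α β a).symm)
      · refine (hβ' _ fun i => hF i.succ).trans (Hom.ext fun X a => (boxLift_inr α β a).symm)

end Box

/-- Genuine `R`-derivations of `R ⊠ T` for a free `T` correspond to families of elements. -/
theorem bijective_der_box (R : TambaraFunctor.{u, w} D) {T : TambaraFunctor.{u, u + 1} D}
    {ι : Type v} {Z : ι → FinGSet G} {t : ∀ i, T.obj (Z i)}
    (hT : IsFreeOn.{u, v, u + 1, max (u + 1) w w'} T Z t) (M : Mod.{u, max (u + 1) w, w'} (R.box T)) :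
    Function.Bijective fun (d : Der (R.boxInl T) M) (i : ι) =>
      d.1 (Z i) ((R.boxInr T).app (Z i) (t i)) := by
  have ext : ∀ F F' : Hom (R.box T) (sqZero M),
      (∀ X r, F.app X ((R.boxInl T).app X r) = F'.app X ((R.boxInl T).app X r)) →
      (∀ i, F.app (Z i) ((R.boxInr T).app (Z i) (t i)) =
        F'.app (Z i) ((R.boxInr T).app (Z i) (t i))) → F = F' := by
    intro F F' h1 h2
    refine tmul_hom_ext _ (fun _ _ _ h => h) (Hom.ext h1) ?_
    exact (hT (sqZero M) _).unique (fun i => h2 i) (fun i => rfl)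
  refine ⟨fun d d' h => ?_, fun m => ?_⟩
  · have hd : Der.toHom _ M d = Der.toHom _ M d' := by
      refine ext _ _ (fun X r => Prod.ext rfl ?_) fun i => Prod.ext rfl (congrFun h i)
      exact (d.2.2.2.1 X r).trans (d'.2.2.2.1 X r).symm
    exact Der.ext _ M fun X a => congrArg (fun F => (F.app X a).2) hd
  · obtain ⟨β, hβ, -⟩ := hT (sqZero M) fun i => ((R.boxInr T).app (Z i) (t i), m i)
    let F : Hom (R.box T) (sqZero M) := boxLift ((sqZeroInl M).comp (R.boxInl T)) β
    have hl : ∀ X r, F.app X ((R.boxInl T).app X r) = ((R.boxInl T).app X r, 0) := fun X r =>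
      boxLift_inl _ _ r
    have hr : ∀ i, F.app (Z i) ((R.boxInr T).app (Z i) (t i)) =
        ((R.boxInr T).app (Z i) (t i), m i) := fun i => (boxLift_inr _ _ _).trans (hβ i)
    -- `F` is a section of the projection. The identity is compared after composing with `S → S ⋉
    -- M`, because freeness of `T` is assumed for targets in the universe of `S ⋉ M`.
    have hF : ((sqZeroInl M).comp (sqZeroFst M)).comp F = sqZeroInl M := by
      refine ext _ _ (fun X r => ?_) fun i => ?_
      · exact congrArg ((sqZeroInl M).comp (sqZeroFst M)|>.app X) (hl X r)
      · exact congrArg ((sqZeroInl M).comp (sqZeroFst M)|>.app (Z i)) (hr i)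
    refine ⟨Der.ofHom _ M F (fun X a => ?_) hl, funext fun i => congrArg Prod.snd (hr i)⟩
    exact congrArg (fun H : Hom (R.box T) (sqZero M) => (H.app X a).1) hF

end Universal

end TambaraFunctor

/-! ### Existence of exponential diagrams -/

namespace FinGSet

variable {G : Type u} [Group G]

/-- The `G`-set of subsets of a finite `G`-set. -/
def powerset (X : FinGSet G) : FinGSet G :=
  letI : MulAction G (Set X) := Set.mulActionSet
  ⟨Set X⟩

/-- Membership in a point of the `G`-set of subsets. -/
def InSet {X : FinGSet G} (x : X) (U : powerset X) : Prop := x ∈ (show Set X from U)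

theorem smul_inSet_smul {X : FinGSet G} (a : G) (x : X) (U : powerset X) :
    InSet (a • x) (a • U) ↔ InSet x U :=
  letI : MulAction G (Set X) := Set.mulActionSet
  Set.smul_mem_smul_set_iff (a := a) (s := (show Set X from U)) (x := x)

theorem inSet_smul {X : FinGSet G} (a : G) (x : X) (U : powerset X) :
    InSet x (a • U) ↔ InSet (a⁻¹ • x) U := by
  rw [← smul_inSet_smul a (a⁻¹ • x), smul_inv_smul]

theorem powerset_ext {X : FinGSet G} {U V : powerset X} (h : ∀ x, InSet x U ↔ InSet x V) :
    U = V := Set.ext h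

/-- Exponential diagrams exist. -/
theorem exists_isExponential {X Y A : FinGSet G} (h : A →[G] X) (g : X →[G] Y) :
    ∃ (Q P : FinGSet G) (e : Q →[G] A) (g' : Q →[G] P) (h' : P →[G] Y),
      IsExponential h g e g' h' := by
  -- a section of `h` over a fibre of `g` is given by its image
  let P : FinGSet G := sub (prod Y (powerset A))
    (fun q => (∀ a, InSet a q.2 → g (h a) = q.1) ∧ ∀ x, g x = q.1 → ∃! a, InSet a q.2 ∧ h a = x)
    (by
      rintro k ⟨y, U⟩ ⟨h1, h2⟩
      refine ⟨fun a ha => ?_, fun x hx => ?_⟩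
      · have := h1 _ ((inSet_smul k a U).1 ha)
        rw [map_smul, map_smul] at this
        exact inv_smul_eq_iff.1 this
      · have hx' : g (k⁻¹ • x) = y := by rw [map_smul]; exact inv_smul_eq_iff.2 hx
        obtain ⟨a, ⟨ha, ha'⟩, hu⟩ := h2 _ hx'
        refine ⟨k • a, ⟨(smul_inSet_smul k a U).2 ha, ?_⟩, fun b hb => ?_⟩
        · rw [map_smul, ha', smul_inv_smul]
        · rw [← hu (k⁻¹ • b) ⟨(inSet_smul k b U).1 hb.1, by rw [map_smul, hb.2]⟩, smul_inv_smul])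
  -- The fibre product `X ×_Y P`: a point `x` of the fibre corresponds to the unique element over
  -- `x` in the image of the section.
  let Q : FinGSet G := sub (prod A P) (fun q => InSet q.1 q.2.1.2)
    fun k q hq => (smul_inSet_smul k q.1 q.2.1.2).2 hq
  refine ⟨Q, P, (prodFst _ _).comp (subVal _ _ _), (prodSnd _ _).comp (subVal _ _ _),
    (prodFst _ _).comp (subVal _ _ _), ⟨fun q => q.1.2.2.1 _ q.2, fun x p hxp => ?_⟩, ?_⟩
  · obtain ⟨a, ⟨ha, ha'⟩, hu⟩ := p.2.2 x hxp
    refine ⟨⟨(a, p), ha⟩, ⟨ha', rfl⟩, ?_⟩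
    rintro ⟨⟨b, p'⟩, hb⟩ ⟨h1, rfl⟩
    exact Subtype.ext (Prod.ext (hu b ⟨hb, h1⟩) rfl)
  · intro y s hs
    have hr : ∀ a, InSet a (show powerset A from Set.range s) ↔ ∃ x, s x = a := fun _ => Iff.rfl
    refine ⟨⟨(y, (Set.range s : Set A)), ?_, ?_⟩, ⟨rfl, ?_⟩, ?_⟩
    · rintro a ⟨x, rfl⟩
      exact (congrArg g (hs x)).trans x.2
    · intro x hx
      refine ⟨s ⟨x, hx⟩, ⟨⟨_, rfl⟩, hs _⟩, ?_⟩
      rintro _ ⟨⟨x', rfl⟩, hx'⟩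
      exact congrArg s (Subtype.ext ((hs x').symm.trans hx'))
    · rintro ⟨⟨a, p⟩, ha⟩ x hp hx
      have hp' : p.1.2 = (Set.range s : Set A) := congrArg (fun p => p.1.2) hp
      have ha' : InSet a p.1.2 := ha
      rw [hp'] at ha'
      obtain ⟨x', rfl⟩ := ha'
      exact congrArg s (Subtype.ext ((hs x').symm.trans hx))
    · rintro ⟨⟨y', U⟩, h1, h2⟩ ⟨hy, h3⟩
      have hy' : y' = y := hy
      subst hy'
      refine Subtype.ext (Prod.ext rfl (powerset_ext fun a => ⟨fun ha => ?_, ?_⟩))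
      · exact ⟨⟨h a, h1 a ha⟩, (h3 ⟨(a, ⟨(y', U), h1, h2⟩), ha⟩ ⟨h a, h1 a ha⟩ rfl rfl).symm⟩
      · rintro ⟨x, rfl⟩
        obtain ⟨a, ⟨ha, ha'⟩, -⟩ := h2 x.1 x.2
        rw [← h3 ⟨(a, ⟨(y', U), h1, h2⟩), ha⟩ x rfl ha']
        exact ha

end FinGSet

/-! ### The norm of a sum -/

namespace TambaraFunctor

variable {G : Type u} [Group G] {D : IndexingCategory G}

/-- The expansion of the norm of a sum up to norms of `b` along 2-surjective maps. -/
theorem exists_nm_add (S : TambaraFunctor.{u, w} D) {X Y : FinGSet G} (f : X →[G] Y)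
    (hf : D.adm f) (a b : S.obj X) :
    ∃ (P U V : FinGSet G) (k : P →[G] Y) (r : U →[G] P) (hr : D.adm r) (t : V →[G] P)
      (ht : D.adm t) (p : U →[G] X) (q : V →[G] X), TwoSurjective t ∧
      S.nm f hf (a + b) = S.nm f hf a + S.tr f (S.puncturedNm f hf a * b) +
        S.tr k (S.nm r hr (S.res p a) * S.nm t ht (S.res q b)) := by
  classical
  obtain ⟨c, rfl, rfl⟩ := S.exists_res_inl_res_inr a b
  -- a section of the fold map over a fibre of `f` is a subset of the fibre
  let P : FinGSet G := sub (prod Y (powerset X)) (fun q => ∀ x, InSet x q.2 → f x = q.1) (by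
    rintro k ⟨y, U⟩ h x hx
    have := h _ ((inSet_smul k x U).1 hx)
    rw [map_smul] at this
    exact inv_smul_eq_iff.1 this)
  let h' : P →[G] Y := (prodFst _ _).comp (subVal _ _ _)
  let Q : FinGSet G := fiberProd f h'
  let g' : Q →[G] P := (prodSnd _ _).comp (subVal _ _ _)
  let fst : Q →[G] X := (prodFst _ _).comp (subVal _ _ _)
  have hQ : IsPullback fst g' f h' := isPullback_fiberProd f h'
  -- The section belonging to a subset takes values in the second copy of `X`, where `c` restricts
  -- to `b`, on the subset, and in the first copy, where `c` restricts to `a`, off it.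
  let e' : Q → coprod X X := fun q =>
    if InSet (fst q) (g' q).1.2 then Sum.inr (fst q) else Sum.inl (fst q)
  have e_pos : ∀ q, InSet (fst q) (g' q).1.2 → e' q = Sum.inr (fst q) := fun q h => if_pos h
  have e_neg : ∀ q, ¬ InSet (fst q) (g' q).1.2 → e' q = Sum.inl (fst q) := fun q h => if_neg h
  let e : Q →[G] coprod X X :=
    { toFun := e'
      map_smul' := fun k q => by
        have := smul_inSet_smul k (fst q) (g' q).1.2
        by_cases h : InSet (fst q) (g' q).1.2
        · exact (e_pos (k • q) (this.2 h)).trans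
            (congrArg (fun z : coprod X X => k • z) (e_pos q h)).symm
        · exact (e_neg (k • q) (mt this.1 h)).trans
            (congrArg (fun z : coprod X X => k • z) (e_neg q h)).symm }
  let fold : coprod X X →[G] X := desc (idHom X) (idHom X)
  have hfe : fold.comp e = fst := DFunLike.ext _ _ fun q => by
    change fold (e' q) = fst q
    by_cases h : InSet (fst q) (g' q).1.2
    · rw [e_pos q h]; rfl
    · rw [e_neg q h]; rfl
  have hexp : IsExponential fold f e g' h' := by
    refine ⟨by rw [hfe]; exact hQ, fun y s hs => ?_⟩
    have hs' : ∀ x, s x = Sum.inl x.1 ∨ s x = Sum.inr x.1 := by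
      intro x
      have := hs x
      rcases hsx : s x with z | z <;> rw [hsx] at this
      · exact Or.inl (congrArg Sum.inl this)
      · exact Or.inr (congrArg Sum.inr this)
    refine ⟨⟨(y, ({x | ∃ hx : f x = y, s ⟨x, hx⟩ = Sum.inr x} : Set X)), fun x hx => hx.1⟩,
      ⟨rfl, ?_⟩, ?_⟩
    · intro q x hp hx
      have hx' : fst q = x.1 := (DFunLike.congr_fun hfe q).symm.trans hx
      have hiff : InSet (fst q) (g' q).1.2 ↔ s x = Sum.inr x.1 := by
        rw [hp, hx']
        exact ⟨fun h => h.2, fun h => ⟨x.2, h⟩⟩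
      change e' q = s x
      by_cases h : InSet (fst q) (g' q).1.2
      · rw [e_pos q h, hiff.1 h, hx']
      · rw [e_neg q h, (hs' x).resolve_right (mt hiff.2 h), hx']
    · rintro ⟨⟨y', U⟩, hU⟩ ⟨hy, h3⟩
      have hy' : y' = y := hy
      subst hy'
      have key : ∀ x (hx : f x = y'), e' ⟨(x, ⟨(y', U), hU⟩), hx⟩ = s ⟨x, hx⟩ := fun x hx =>
        h3 _ ⟨x, hx⟩ rfl (DFunLike.congr_fun hfe _)
      refine Subtype.ext (Prod.ext rfl (powerset_ext fun x => ⟨fun hx => ?_, ?_⟩))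
      · exact ⟨hU x hx, (key x (hU x hx)).symm.trans (e_pos _ hx)⟩
      · rintro ⟨hx, hsx⟩
        by_contra hn
        rw [← key x hx, e_neg ⟨(x, ⟨(y', U), hU⟩), hx⟩ hn] at hsx
        exact Sum.inl_ne_inr hsx
  -- subsets with no elements, with one element, and with at least two elements
  let j₀ : Y →[G] P :=
    { toFun := fun y => ⟨(y, (∅ : Set X)), fun _ hx => hx.elim⟩
      map_smul' := fun k y => Subtype.ext (Prod.ext rfl (powerset_ext fun x =>
        ⟨fun hx => hx.elim, fun hx => ((inSet_smul k x _).1 hx).elim⟩)) }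
  let j₁ : X →[G] P :=
    { toFun := fun x => ⟨(f x, ({x} : Set X)), fun z hz => congrArg f (show z = x from hz)⟩
      map_smul' := fun k x => Subtype.ext (Prod.ext (map_smul f k x) (powerset_ext fun z =>
        (show z = k • x ↔ k⁻¹ • z = x from inv_smul_eq_iff.symm).trans (inSet_smul k z ({x} : Set X)).symm)) }
  let P₂ : FinGSet G := sub P (fun p => ∃ x x', x ≠ x' ∧ InSet x p.1.2 ∧ InSet x' p.1.2) (by
    rintro k p ⟨x, x', hne, hx, hx'⟩
    exact ⟨k • x, k • x', fun h => hne (MulAction.injective k h), (smul_inSet_smul _ _ _).2 hx,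
      (smul_inSet_smul _ _ _).2 hx'⟩)
  let j₂ : P₂ →[G] P := subVal _ _ _
  have hj : IsCoprod (desc j₀ j₁) j₂ := by
    refine .of_cases ?_ Subtype.val_injective ?_ ?_
    · rintro (y | x) (y' | x') h
      · exact congrArg (fun p : P => (Sum.inl p.1.1 : Y ⊕ X)) h
      · have : InSet x' (j₀ y).1.2 := by rw [show j₀ y = j₁ x' from h]; exact rfl
        exact this.elim
      · have : InSet x (j₀ y').1.2 := by rw [show j₀ y' = j₁ x from h.symm]; exact rfl
        exact this.elim
      · have : InSet x (j₁ x').1.2 := by rw [show j₁ x' = j₁ x from h.symm]; exact rfl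
        exact congrArg Sum.inr this
    · rintro (y | x) ⟨p, z, z', hne, hz, hz'⟩ h
      · have h' : p = j₀ y := h.symm
        subst h'
        exact hz.elim
      · have h' : p = j₁ x := h.symm
        subst h'
        exact hne ((show z = x from hz).trans (show z' = x from hz').symm)
    · rintro p
      by_cases h : ∃ x x', x ≠ x' ∧ InSet x p.1.2 ∧ InSet x' p.1.2
      · exact Or.inr ⟨⟨p, h⟩, rfl⟩
      · push Not at h
        refine Or.inl ?_
        by_cases h0 : ∃ x, InSet x p.1.2
        · obtain ⟨x, hx⟩ := h0
          refine ⟨Sum.inr x, Subtype.ext (Prod.ext (p.2 x hx) (powerset_ext fun z => ⟨?_, ?_⟩))⟩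
          · rintro (rfl : z = x)
            exact hx
          · intro hz
            by_contra hne
            exact h z x hne hz hx
        · push Not at h0
          exact ⟨Sum.inl p.1.1, Subtype.ext (Prod.ext rfl (powerset_ext fun z =>
            ⟨fun hz => hz.elim, fun hz => (h0 z hz).elim⟩))⟩
  -- Over the empty subsets all values are taken from `a`; this part gives `N_f a`.
  let k₀ : X →[G] Q :=
    { toFun := fun x => ⟨(x, j₀ (f x)), rfl⟩
      map_smul' := fun k x => Subtype.ext (Prod.ext rfl ((congrArg j₀ (map_smul f k x)).trans
        (map_smul j₀ k (f x)))) }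
  have hk₀ : IsPullback k₀ f g' j₀ := by
    refine ⟨fun _ => rfl, ?_⟩
    rintro ⟨⟨x, p⟩, hx⟩ y (rfl : p = j₀ y)
    have hx' : f x = y := hx
    subst hx'
    exact ⟨x, ⟨rfl, rfl⟩, fun z hz => congrArg fst hz.1⟩
  have hd := isPullback_desc_offDiag f
  -- Over the singletons `{x}`, `Q` becomes `X ×_Y X`: the diagonal carries `b` and its complement
  -- carries `a`. This is the linear term.
  let k₁ : coprod (offDiag f) X →[G] Q :=
    { toFun := fun z => ⟨(desc (offDiagFst f) (idHom X) z, j₁ (desc (offDiagSnd f) (idHom X) z)),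
        hd.1 z⟩
      map_smul' := fun k z => Subtype.ext (Prod.ext (map_smul _ k z)
        ((congrArg j₁ (map_smul _ k z)).trans (map_smul j₁ k _))) }
  have hk₁ : IsPullback k₁ (desc (offDiagSnd f) (idHom X)) g' j₁ := by
    refine ⟨fun _ => rfl, ?_⟩
    rintro ⟨⟨x, p⟩, hx⟩ x' (rfl : p = j₁ x')
    obtain ⟨z, ⟨h1, h2⟩, hu⟩ := hd.2 x x' hx
    refine ⟨z, ⟨Subtype.ext (Prod.ext h1 (congrArg j₁ h2)), h2⟩, fun z' hz' => ?_⟩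
    exact hu z' ⟨congrArg fst hz'.1, hz'.2⟩
  let Q₂ : FinGSet G := fiberProd g' j₂
  let k₂ : Q₂ →[G] Q := (prodFst _ _).comp (subVal _ _ _)
  let g₂ : Q₂ →[G] P₂ := (prodSnd _ _).comp (subVal _ _ _)
  have hk₂ : IsPullback k₂ g₂ g' j₂ := isPullback_fiberProd g' j₂
  -- Over the larger subsets each fibre splits into the points outside the subset (`U`, carrying
  -- `a`) and those inside it (`V`, carrying `b`). The subsets have at least two elements, so `V →
  -- P₂` is 2-surjective.
  let U : FinGSet G := sub Q₂ (fun z => ¬ InSet (fst (k₂ z)) (g' (k₂ z)).1.2)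
    fun k z hz => mt (smul_inSet_smul k _ _).1 hz
  let V : FinGSet G := sub Q₂ (fun z => InSet (fst (k₂ z)) (g' (k₂ z)).1.2)
    fun k z hz => (smul_inSet_smul k _ _).2 hz
  let iU : U →[G] Q₂ := subVal _ _ _
  let iV : V →[G] Q₂ := subVal _ _ _
  have hUV : IsCoprod iU iV := by
    refine .of_cases Subtype.val_injective Subtype.val_injective ?_ fun z => ?_
    · rintro ⟨z, hz⟩ ⟨z', hz'⟩ (rfl : z = z')
      exact hz hz'
    · by_cases h : InSet (fst (k₂ z)) (g' (k₂ z)).1.2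
      · exact Or.inr ⟨⟨z, h⟩, rfl⟩
      · exact Or.inl ⟨⟨z, h⟩, rfl⟩
  have hg' : D.adm g' := D.adm_pullback _ _ _ _ hQ hf
  have hg₂ : D.adm g₂ := D.adm_pullback _ _ _ _ hk₂ hg'
  have hi : D.adm iU ∧ D.adm iV := by
    have := D.adm_of_bijective _ hUV
    exact ⟨D.adm_comp _ _ this (D.adm_inl U V), D.adm_comp _ _ this (D.adm_inr U V)⟩
  have hU : D.adm (g₂.comp iU) := D.adm_comp _ _ hg₂ hi.1
  have hV : D.adm (g₂.comp iV) := D.adm_comp _ _ hg₂ hi.2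
  refine ⟨P₂, U, V, h'.comp j₂, g₂.comp iU, hU, g₂.comp iV, hV, fst.comp (k₂.comp iU),
    fst.comp (k₂.comp iV), ?_, ?_⟩
  · rintro ⟨p, x, x', hne, hx, hx'⟩
    refine ⟨⟨⟨(⟨(x, p), p.2 x hx⟩, ⟨p, x, x', hne, hx, hx'⟩), rfl⟩, hx⟩,
      ⟨⟨(⟨(x', p), p.2 x' hx'⟩, ⟨p, x, x', hne, hx, hx'⟩), rfl⟩, hx'⟩,
      fun h => hne (congrArg (fun z => fst (k₂ (iV z))) h), rfl, rfl⟩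
  · have e₀ : e.comp k₀ = inl X X := DFunLike.ext _ _ fun x => e_neg _ fun h => h.elim
    have e₁l : (e.comp k₁).comp (inl _ _) = (inl X X).comp (offDiagFst f) :=
      DFunLike.ext _ _ fun z => e_neg _ fun h => z.2.2 h
    have e₁r : (e.comp k₁).comp (inr _ _) = inr X X := DFunLike.ext _ _ fun z => e_pos _ rfl
    have eU : (e.comp k₂).comp iU = (inl X X).comp (fst.comp (k₂.comp iU)) :=
      DFunLike.ext _ _ fun z => e_neg _ z.2
    have eV : (e.comp k₂).comp iV = (inr X X).comp (fst.comp (k₂.comp iV)) :=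
      DFunLike.ext _ _ fun z => e_pos _ z.2
    have hsum : S.tr fold c = S.res (inl X X) c + S.res (inr X X) c := by
      rw [S.tr_desc, S.tr_id, S.tr_id]
    rw [← hsum, S.nm_tr _ _ _ _ _ hexp, S.tr_of_isCoprod hj,
      show h'.comp (desc j₀ j₁) = desc (idHom Y) f from
        DFunLike.ext _ _ (by rintro (y | x) <;> rfl), S.tr_desc, S.tr_id, ← S.res_comp,
      ← S.res_comp, S.res_congr (show (desc j₀ j₁).comp (inl Y X) = j₀ from rfl),
      S.res_congr (show (desc j₀ j₁).comp (inr Y X) = j₁ from rfl), S.res_nm _ _ _ _ hk₀,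
      S.res_nm _ _ _ _ hk₁, S.res_nm _ _ _ _ hk₂, S.nm_of_isCoprod hUV _ _ hU hV,
      S.nm_desc _ _ (D.adm_offDiagSnd f hf) (D.adm_id X), S.nm_id]
    simp only [← S.res_comp]
    rw [e₀, e₁l, e₁r, eU, eV, puncturedNm_apply, ← S.res_comp]

end TambaraFunctor

theorem FinGSet.exists_isPullback {G : Type u} [Group G] {X Y Z : FinGSet G} (f : X →[G] Z)
    (g : Y →[G] Z) :
    ∃ (P : FinGSet G) (p : P →[G] X) (q : P →[G] Y), IsPullback p q f g :=
  ⟨_, _, _, isPullback_fiberProd f g⟩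

namespace TambaraFunctor

variable {G : Type u} [Group G] {D : IndexingCategory G}

/-! ### Elements of box products as single transfers -/

section Generation

variable {R : TambaraFunctor.{u, w} D} {T : TambaraFunctor.{u, w'} D}

/-- Every element of a functor with the relations of the box product is a transfer of a symbol
`m ⊗ n`. -/
theorem exists_eq_tr_tmul (rel : ∀ X : FinGSet G, Term D (fun X => R.obj X × T.obj X) X →
      Term D (fun X => R.obj X × T.obj X) X → Prop)
    (h : ∀ X a b, BoxRel R T X a b → rel X a b) {X : FinGSet G} (z : (Presented rel).obj X) :
    ∃ (Y : FinGSet G) (f : Y →[G] X) (m : R.obj Y) (n : T.obj Y),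
      z = (Presented rel).tr f ((tmulLeft rel h).app Y m * (tmulRight rel h).app Y n) := by
  let S : TambaraFunctor D := Presented rel
  let l : Hom R S := tmulLeft rel h
  let r : Hom T S := tmulRight rel h
  -- Symbols over `Y` and `Y'` glue to one symbol over `Y ⊔ Y'`, so one transfer suffices for a sum.
  have add : ∀ {X : FinGSet G} (z z' : S.obj X),
      (∃ (Y : FinGSet G) (f : Y →[G] X) (m : R.obj Y) (n : T.obj Y),
        z = S.tr f (l.app Y m * r.app Y n)) →
      (∃ (Y : FinGSet G) (f : Y →[G] X) (m : R.obj Y) (n : T.obj Y),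
        z' = S.tr f (l.app Y m * r.app Y n)) →
      ∃ (Y : FinGSet G) (f : Y →[G] X) (m : R.obj Y) (n : T.obj Y),
        z + z' = S.tr f (l.app Y m * r.app Y n) := by
    rintro X _ _ ⟨Y, f, m, n, rfl⟩ ⟨Y', f', m', n', rfl⟩
    obtain ⟨m₀, rfl, rfl⟩ := R.exists_res_inl_res_inr m m'
    obtain ⟨n₀, rfl, rfl⟩ := T.exists_res_inl_res_inr n n'
    refine ⟨coprod Y Y', desc f f', m₀, n₀, ?_⟩
    rw [S.tr_desc, map_mul (S.res _), map_mul (S.res _), l.app_res, l.app_res, r.app_res, r.app_res]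
  have mul : ∀ {X : FinGSet G} (z z' : S.obj X),
      (∃ (Y : FinGSet G) (f : Y →[G] X) (m : R.obj Y) (n : T.obj Y),
        z = S.tr f (l.app Y m * r.app Y n)) →
      (∃ (Y : FinGSet G) (f : Y →[G] X) (m : R.obj Y) (n : T.obj Y),
        z' = S.tr f (l.app Y m * r.app Y n)) →
      ∃ (Y : FinGSet G) (f : Y →[G] X) (m : R.obj Y) (n : T.obj Y),
        z * z' = S.tr f (l.app Y m * r.app Y n) := by
    rintro X _ _ ⟨Y, f, m, n, rfl⟩ ⟨Y', f', m', n', rfl⟩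
    obtain ⟨P, p, q, hp⟩ := exists_isPullback f' f
    refine ⟨P, f.comp q, R.res q m * R.res p m', T.res q n * T.res p n', ?_⟩
    rw [← S.tr_mul_res, S.res_tr _ _ _ _ hp, mul_comm, ← S.tr_mul_res, ← S.tr_comp,
      map_mul (S.res _), map_mul (S.res _), map_mul (l.app _), map_mul (r.app _), l.app_res,
      l.app_res, r.app_res, r.app_res, mul_mul_mul_comm, mul_comm (S.res p _),
      mul_comm (S.res p _)]
  have key : ∀ {X : FinGSet G} (t : Term D (fun X => R.obj X × T.obj X) X),
      ∃ (Y : FinGSet G) (f : Y →[G] X) (m : R.obj Y) (n : T.obj Y),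
        (Presented.mk rel t : S.obj X) = S.tr f (l.app Y m * r.app Y n) := by
    intro X t
    induction t with
    | of p =>
      refine ⟨_, idHom _, p.1, p.2, ?_⟩
      rw [S.tr_id]
      exact mk_tmul rel h p.1 p.2
    | zero =>
      refine ⟨_, idHom _, 0, 0, ?_⟩
      rw [map_zero, zero_mul, map_zero]
      rfl
    | one =>
      refine ⟨_, idHom _, 1, 1, ?_⟩
      rw [map_one, map_one, mul_one, S.tr_id]
      rfl
    | add a b iha ihb => exact add _ _ iha ihb
    | mul a b iha ihb => exact mul _ _ iha ihb
    | neg a iha =>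
      obtain ⟨Y, f, m, n, hz⟩ := iha
      refine ⟨Y, f, -m, n, ?_⟩
      change -(Presented.mk rel a : S.obj _) = _
      rw [hz, map_neg (l.app _), neg_mul, map_neg]
      rfl
    | res g a iha =>
      obtain ⟨Y, f, m, n, hz⟩ := iha
      obtain ⟨P, p, q, hp⟩ := exists_isPullback f g
      refine ⟨P, q, R.res p m, T.res p n, ?_⟩
      change S.res g (Presented.mk rel a : S.obj _) = _
      rw [hz, S.res_tr _ _ _ _ hp, map_mul, l.app_res, r.app_res]
    | tr g a iha =>
      obtain ⟨Y, f, m, n, hz⟩ := iha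
      refine ⟨Y, g.comp f, m, n, ?_⟩
      change S.tr g (Presented.mk rel a : S.obj _) = _
      rw [hz, S.tr_comp]
    | nm g hg a iha =>
      obtain ⟨Y, f, m, n, hz⟩ := iha
      -- The Tambara relation turns the norm of a transfer into a transfer of a norm, and norms of
      -- symbols are symbols.
      obtain ⟨Q, P, e, g', h', he⟩ := exists_isExponential f g
      have hg' := D.adm_pullback _ _ _ _ he.1 hg
      refine ⟨P, h', R.nm g' hg' (R.res e m), T.nm g' hg' (T.res e n), ?_⟩
      change S.nm g hg (Presented.mk rel a : S.obj _) = _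
      rw [hz, S.nm_tr _ _ _ _ _ he, map_mul, map_mul, l.app_nm, r.app_nm, l.app_res, r.app_res]
  exact Presented.ind (rel := rel) (p := fun z : S.obj X => ∃ (Y : FinGSet G) (f : Y →[G] X)
    (m : R.obj Y) (n : T.obj Y), z = S.tr f (l.app Y m * r.app Y n)) key z

end Generation

/-! ### The ideal `I^{>1}` and the first-order expansion of norms -/

theorem IdealFamily.nm_mem_gtOne {S : TambaraFunctor.{u, w} D} (I : IdealFamily S)
    {X Y : FinGSet G} (f : X →[G] Y) (hf : D.adm f) (h : TwoSurjective f) {i : S.obj X}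
    (hi : i ∈ I.carrier X) : S.nm f hf i ∈ I.gtOne.carrier Y := by
  simp only [IdealFamily.gtOne, Submodule.mem_iInf]
  exact fun J hJ => hJ f hf h i hi

theorem IdealFamily.gtOne_le {S : TambaraFunctor.{u, w} D} (I J : IdealFamily S)
    (hJ : ∀ {X Y : FinGSet G} (f : X →[G] Y) (hf : D.adm f), TwoSurjective f →
      ∀ i ∈ I.carrier X, S.nm f hf i ∈ J.carrier Y) (X : FinGSet G) :
    I.gtOne.carrier X ≤ J.carrier X := fun a ha => by
  simp only [IdealFamily.gtOne, Submodule.mem_iInf] at ha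
  exact ha J hJ

/-- The remainder in `exists_nm_add` is a transfer of a multiple of a norm, along a 2-surjective
map, of a restriction of `i`. -/
theorem IdealFamily.nm_add_sub_mem_gtOne {S : TambaraFunctor.{u, w} D} (I : IdealFamily S)
    {X Y : FinGSet G} (f : X →[G] Y) (hf : D.adm f) (a : S.obj X) {i : S.obj X}
    (hi : i ∈ I.carrier X) :
    S.nm f hf (a + i) - S.nm f hf a - S.tr f (S.puncturedNm f hf a * i) ∈ I.gtOne.carrier Y := by
  obtain ⟨P, U, V, k, r, hr, t, ht, p, q, ht2, h⟩ := S.exists_nm_add f hf a i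
  rw [h, sub_sub, add_sub_cancel_left]
  exact I.gtOne.tr_mem k (Ideal.mul_mem_left _ _ (I.nm_mem_gtOne t ht ht2 (I.res_mem q hi)))

theorem Hom.app_puncturedNm {R : TambaraFunctor.{u, w} D} {S : TambaraFunctor.{u, w'} D}
    (F : Hom R S) {X Y : FinGSet G} (f : X →[G] Y) (hf : D.adm f) (s : R.obj X) :
    F.app X (R.puncturedNm f hf s) = S.puncturedNm f hf (F.app X s) := by
  rw [puncturedNm_apply, F.app_nm, F.app_res, puncturedNm_apply]

theorem Mod.Hom.ext {S : TambaraFunctor.{u, w} D} {M : Mod.{u, w, w'} S} {N : Mod.{u, w, w''} S}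
    {F F' : Mod.Hom M N} (h : ∀ X m, F.app X m = F'.app X m) : F = F' := by
  cases F; cases F'
  congr
  funext X
  exact LinearMap.ext (h X)

/-! ### Kähler differentials represent genuine derivations -/

section Kaehler

variable {A : TambaraFunctor.{u, w} D} {B : TambaraFunctor.{u, w'} D} (φ : Hom A B)

theorem relBoxInr_app_app {X : FinGSet G} (a : A.obj X) :
    (relBoxInr φ).app X (φ.app X a) = (relBoxInl φ).app X (φ.app X a) := by
  have := Presented.sound (.of (RelBoxRel.balance (φ := φ) (ψ := φ) (1 : B.obj X) a 1))
  rw [one_mul, mul_one] at this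
  exact this.symm

theorem relBoxMul_inl {X : FinGSet G} (b : B.obj X) :
    (relBoxMul φ).app X ((relBoxInl φ).app X b) = b := mul_one b

theorem relBoxMul_inr {X : FinGSet G} (b : B.obj X) :
    (relBoxMul φ).app X ((relBoxInr φ).app X b) = b := one_mul b

theorem relBoxInr_sub_inl_mem {X : FinGSet G} (b : B.obj X) :
    (relBoxInr φ).app X b - (relBoxInl φ).app X b ∈ (relBoxMul φ).ker.carrier X := by
  refine RingHom.mem_ker.2 ?_
  rw [map_sub, relBoxMul_inl, relBoxMul_inr, sub_self]

/-- The universal derivation `δ` as a genuine derivation. -/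
def kaehlerDer : Der φ (kaehler φ) where
  val X :=
    { toFun := fun b => kaehlerD φ b
      map_zero' := congrArg (Submodule.Quotient.mk (p := (relBoxMul φ).ker.inter _ X))
        (Subtype.ext
        (show (relBoxInr φ).app X 0 - (relBoxInl φ).app X 0 = 0 by
          rw [map_zero, map_zero, sub_zero]))
      map_add' := fun a b => congrArg (Submodule.Quotient.mk (p := (relBoxMul φ).ker.inter _ X))
        (Subtype.ext (show (relBoxInr φ).app X (a + b) - (relBoxInl φ).app X (a + b) =
            ((relBoxInr φ).app X a - (relBoxInl φ).app X a) +
              ((relBoxInr φ).app X b - (relBoxInl φ).app X b) by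
          rw [map_add, map_add, add_sub_add_comm])) }
  property := by
    refine ⟨fun {X Y} f s => ?_, fun {X Y} f s => ?_, fun X a => ?_, fun {X Y} f hf s => ?_⟩
    · exact congrArg (Submodule.Quotient.mk (p := (relBoxMul φ).ker.inter _ X))
        (Subtype.ext (show (relBoxInr φ).app X (B.res f s) - (relBoxInl φ).app X (B.res f s) =
            (relBox φ φ).res f ((relBoxInr φ).app Y s - (relBoxInl φ).app Y s) by
          rw [Hom.app_res, Hom.app_res, map_sub]))
    · exact congrArg (Submodule.Quotient.mk (p := (relBoxMul φ).ker.inter _ Y))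
        (Subtype.ext (show (relBoxInr φ).app Y (B.tr f s) - (relBoxInl φ).app Y (B.tr f s) =
            (relBox φ φ).tr f ((relBoxInr φ).app X s - (relBoxInl φ).app X s) by
          rw [Hom.app_tr, Hom.app_tr, map_sub]))
    · exact congrArg (Submodule.Quotient.mk (p := (relBoxMul φ).ker.inter _ X))
        (Subtype.ext (show (relBoxInr φ).app X (φ.app X a) - (relBoxInl φ).app X (φ.app X a) = 0 by
          rw [relBoxInr_app_app, sub_self]))
    · refine (Submodule.Quotient.eq ((relBoxMul φ).ker.inter _ Y)).2 ?_
      change ((relBoxInr φ).app Y (B.nm f hf s) - (relBoxInl φ).app Y (B.nm f hf s)) -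
        (relBox φ φ).tr f ((relBoxInl φ).app X (B.puncturedNm f hf s) *
          ((relBoxInr φ).app X s - (relBoxInl φ).app X s)) ∈ (relBoxMul φ).ker.gtOne.carrier Y
      -- The expansion is taken at `s ⊗ 1` with increment `1 ⊗ s - s ⊗ 1`, whose sum is `1 ⊗ s`.
      have := (relBoxMul φ).ker.nm_add_sub_mem_gtOne f hf ((relBoxInl φ).app X s)
        (relBoxInr_sub_inl_mem φ s)
      rwa [add_sub_cancel, ← Hom.app_puncturedNm, ← Hom.app_nm, ← Hom.app_nm] at this

/-- The composite of a genuine derivation and a homomorphism of modules. -/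
def Der.mapMod {M : Mod.{u, w', w''} B} {N : Mod.{u, w', v} B} (F : Mod.Hom M N) (d : Der φ M) :
    Der φ N where
  val X := (F.app X).toAddMonoidHom.comp (d.1 X)
  property := by
    obtain ⟨h1, h2, h3, h4⟩ := d.2
    refine ⟨fun {X Y} f s => ?_, fun {X Y} f s => ?_, fun X a => ?_, fun {X Y} f hf s => ?_⟩
    · change F.app X (d.1 X _) = N.res f (F.app Y (d.1 Y s))
      rw [h1, F.app_res]
    · change F.app Y (d.1 Y _) = N.tr f (F.app X (d.1 X s))
      rw [h2, F.app_tr]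
    · change F.app X (d.1 X _) = 0
      rw [h3, map_zero]
    · change F.app Y (d.1 Y _) = N.tr f (_ • F.app X (d.1 X s))
      rw [h4, F.app_tr, map_smul]

/-- The Kähler differentials are generated by the transfers of multiples of the `δ b`. -/
theorem exists_eq_tr_smul_kaehlerD {X : FinGSet G} (m : (kaehler φ).obj X) :
    ∃ (Y : FinGSet G) (f : Y →[G] X) (b b' : B.obj Y),
      m = (kaehler φ).tr f (b • (kaehlerD φ b' : (kaehler φ).obj Y)) := by
  obtain ⟨⟨z, hz⟩⟩ := m
  obtain ⟨Y, f, b, b', rfl⟩ := exists_eq_tr_tmul (RelBoxRel φ φ) (fun _ _ _ h => .box _ _ h) z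
  refine ⟨Y, f, b, b', congrArg (Submodule.Quotient.mk (p := (relBoxMul φ).ker.inter _ X))
    (Subtype.ext ?_)⟩
  change (relBox φ φ).tr f ((relBoxInl φ).app Y b * (relBoxInr φ).app Y b') =
    (relBox φ φ).tr f ((relBoxInl φ).app Y b *
      ((relBoxInr φ).app Y b' - (relBoxInl φ).app Y b'))
  -- Replacing `1 ⊗ b'` by `1 ⊗ b' - b' ⊗ 1` changes the transfer by `T_f (b * b') ⊗ 1`, which
  -- vanishes because the element lies in the kernel of `μ`.
  have h0 : B.tr f (b * b') = 0 := by
    have h : (relBoxMul φ).app X ((relBox φ φ).tr f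
      ((relBoxInl φ).app Y b * (relBoxInr φ).app Y b')) = 0 := RingHom.mem_ker.1 hz
    rwa [Hom.app_tr, map_mul, relBoxMul_inl, relBoxMul_inr] at h
  rw [mul_sub, map_sub, ← map_mul, ← Hom.app_tr, h0, map_zero, sub_zero]

/-- The morphism `B ⊠_A B → B ⋉ M`, `b ⊗ b' ↦ (b, 0) (b', d b')` given by a genuine derivation. -/
def Der.relBoxHom {M : Mod.{u, w', w''} B} (d : Der φ M) : Hom (relBox φ φ) (sqZero M) :=
  Presented.lift (sqZero M)
    (fun X p => (sqZeroInl M).app X p.1 * (Der.toHom φ M d).app X p.2) (by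
      rintro X a b (⟨_, _, h⟩ | ⟨b, a, c⟩)
      · exact eval_eq_of_boxRel _ _ h
      · change (sqZeroInl M).app X (b * φ.app X a) * (Der.toHom φ M d).app X c =
          (sqZeroInl M).app X b * (Der.toHom φ M d).app X (φ.app X a * c)
        have : (Der.toHom φ M d).app X (φ.app X a) = (sqZeroInl M).app X (φ.app X a) :=
          Prod.ext rfl (d.2.2.2.1 X a)
        rw [map_mul, map_mul, this, mul_assoc])

theorem Der.relBoxHom_inl {M : Mod.{u, w', w''} B} (d : Der φ M) {X : FinGSet G} (b : B.obj X) :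
    (Der.relBoxHom φ d).app X ((relBoxInl φ).app X b) = (sqZeroInl M).app X b := by
  change (sqZeroInl M).app X b * (Der.toHom φ M d).app X 1 = _
  rw [_root_.map_one, mul_one]

theorem Der.relBoxHom_inr {M : Mod.{u, w', w''} B} (d : Der φ M) {X : FinGSet G} (b : B.obj X) :
    (Der.relBoxHom φ d).app X ((relBoxInr φ).app X b) = (Der.toHom φ M d).app X b := by
  change (sqZeroInl M).app X 1 * (Der.toHom φ M d).app X b = _
  rw [_root_.map_one, one_mul]

/-- Both sides are morphisms that restrict to the identity along the two inclusions. Consequently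
`I` is sent into `0 ⊕ M`. -/
theorem Der.relBoxHom_fst {M : Mod.{u, w', w''} B} (d : Der φ M) {X : FinGSet G}
    (z : (relBox φ φ).obj X) : ((Der.relBoxHom φ d).app X z).1 = (relBoxMul φ).app X z := by
  have : (sqZeroFst M).comp (Der.relBoxHom φ d) = relBoxMul φ := by
    refine tmul_hom_ext (RelBoxRel φ φ) (fun _ _ _ h => .box _ _ h) (Hom.ext fun X b => ?_)
      (Hom.ext fun X b => ?_)
    · exact (congrArg ((sqZeroFst M).app X) (Der.relBoxHom_inl φ d b)).trans
        (relBoxMul_inl φ b).symm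
    · exact (congrArg ((sqZeroFst M).app X) (Der.relBoxHom_inr φ d b)).trans
        (relBoxMul_inr φ b).symm
  exact congrArg (fun H : Hom (relBox φ φ) B => H.app X z) this

/-- The kernel of the morphism is an ideal, so only the generators of `I^{>1}` matter. An element of
`I` goes to some `(0, m)`, and both coordinates of the norm of `(0, m)` along a 2-surjective map
vanish: `N_f 0` and the punctured norm of `0` are zero. -/
theorem Der.relBoxHom_of_mem_gtOne {M : Mod.{u, w', w''} B} (d : Der φ M) {X : FinGSet G}
    {z : (relBox φ φ).obj X} (hz : z ∈ (relBoxMul φ).ker.gtOne.carrier X) :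
    (Der.relBoxHom φ d).app X z = 0 := by
  refine RingHom.mem_ker.1 (IdealFamily.gtOne_le _ (Der.relBoxHom φ d).ker ?_ X hz)
  intro X Y f hf h2 i hi
  have hs : Function.Surjective f := fun y => by
    obtain ⟨x, -, -, hx, -⟩ := h2 y
    exact ⟨x, hx⟩
  have h0 : ((Der.relBoxHom φ d).app X i).1 = 0 :=
    (Der.relBoxHom_fst φ d i).trans (RingHom.mem_ker.1 hi)
  refine RingHom.mem_ker.2 ?_
  rw [Hom.app_nm]
  refine Prod.ext ?_ ?_
  · change B.nm f hf ((Der.relBoxHom φ d).app X i).1 = 0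
    rw [h0, B.nm_zero f hf hs]
  · change M.tr f (B.puncturedNm f hf ((Der.relBoxHom φ d).app X i).1 • _) = 0
    rw [h0, B.puncturedNm_zero f hf h2, zero_smul, map_zero]

/-- The homomorphism `Ω → M` through which a genuine derivation factors. -/
def Der.kaehlerLift {M : Mod.{u, w', w''} B} (d : Der φ M) : Mod.Hom (kaehler φ) M where
  app X :=
    { toFun := QuotientAddGroup.lift
        ((relBoxMul φ).ker.inter (relBoxMul φ).ker.gtOne X).toAddSubgroup
        { toFun := fun z => ((Der.relBoxHom φ d).app X z.1).2
          map_zero' := congrArg Prod.snd (map_zero ((Der.relBoxHom φ d).app X))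
          map_add' := fun a b => congrArg Prod.snd (map_add ((Der.relBoxHom φ d).app X) a.1 b.1) }
        fun z hz => congrArg Prod.snd (Der.relBoxHom_of_mem_gtOne φ d hz)
      map_add' := map_add _
      map_smul' := by
        rintro b ⟨z⟩
        change ((Der.relBoxHom φ d).app X ((relBoxInl φ).app X b * z.1)).2 =
          b • ((Der.relBoxHom φ d).app X z.1).2
        rw [map_mul, Der.relBoxHom_inl]
        change b • ((Der.relBoxHom φ d).app X z.1).2 +
          ((Der.relBoxHom φ d).app X z.1).1 • (0 : M.obj X) = _
        rw [smul_zero, add_zero] }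
  app_res := by
    rintro X Y f ⟨z⟩
    exact congrArg Prod.snd ((Der.relBoxHom φ d).app_res f z.1)
  app_tr := by
    rintro X Y f ⟨z⟩
    exact congrArg Prod.snd ((Der.relBoxHom φ d).app_tr f z.1)

theorem Der.kaehlerLift_kaehlerD {M : Mod.{u, w', w''} B} (d : Der φ M) {X : FinGSet G}
    (b : B.obj X) : (Der.kaehlerLift φ d).app X (kaehlerD φ b) = d.1 X b := by
  change ((Der.relBoxHom φ d).app X ((relBoxInr φ).app X b - (relBoxInl φ).app X b)).2 = _
  rw [map_sub, Der.relBoxHom_inl, Der.relBoxHom_inr]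
  exact sub_zero (d.1 X b)

/-- If genuine derivations into every module correspond to families of elements through evaluation
at `x i`, the Kähler differentials are free on the `δ (x i)`. -/
theorem kaehler_isBasis {ι : Type v} {Z : ι → FinGSet G} (x : ∀ i, B.obj (Z i))
    (h : ∀ N : Mod.{u, w', w''} B,
      Function.Bijective fun (d : Der φ N) (i : ι) => d.1 (Z i) (x i)) :
    Mod.IsBasis.{u, v, w', max (u + 1) w', w''} (kaehler φ) Z fun i => kaehlerD φ (x i) := by
  intro N n
  obtain ⟨d, hd⟩ := (h N).2 n
  refine ⟨Der.kaehlerLift φ d, fun i => (Der.kaehlerLift_kaehlerD φ d _).trans (congrFun hd i),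
    fun F hF => Mod.Hom.ext fun X m => ?_⟩
  -- The composite of `δ` with any competitor `F` is a derivation with the prescribed values at the
  -- `x i`, hence equals `d`. So `F` is determined on the `δ b`, which generate `Ω`.
  have hFd : Der.mapMod φ F (kaehlerDer φ) = d :=
    (h N).1 ((funext hF : (fun i => F.app (Z i) (kaehlerD φ (x i))) = n).trans hd.symm)
  have key : ∀ (X : FinGSet G) (b : B.obj X),
      F.app X (kaehlerD φ b) = (Der.kaehlerLift φ d).app X (kaehlerD φ b) := fun X b =>
    (congrArg (fun d : Der φ N => d.1 X b) hFd).trans (Der.kaehlerLift_kaehlerD φ d b).symm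
  obtain ⟨Y, f, b, b', rfl⟩ := exists_eq_tr_smul_kaehlerD φ m
  rw [F.app_tr, Mod.Hom.app_tr, map_smul (F.app Y), map_smul ((Der.kaehlerLift φ d).app Y), key]

end Kaehler

end TambaraFunctor

/-! ### The theorem -/

theorem mainTheorem4 {G : Type u} [Group G] [Finite G] (D : IndexingCategory G)
    (R : TambaraFunctor.{u, w} D) :
    -- `φ`-derivations into `M` correspond to the elements of `M(G/H)`, via `d ↦ d (1 ⊗ Id)`
    (∀ (H : Subgroup G)
      (M : TambaraFunctor.Mod.{u, max (u + 1) w, w'} (R.box (TambaraFunctor.free D (orbit H)))),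
      Function.Bijective
        (TambaraFunctor.Der.eval (R.boxInl (TambaraFunctor.free D (orbit H))) M
          (R.polyGen (orbit H)))) ∧
    -- `Ω` is free on the generator `δ (1 ⊗ Id)` at `G/H`
    (∀ H : Subgroup G,
      TambaraFunctor.Mod.IsBasis.{u, 0, max (u + 1) w, max (u + 1) w, w''}
        (TambaraFunctor.kaehler (R.boxInl (TambaraFunctor.free D (orbit H))))
        (fun _ : Unit => orbit H)
        (fun _ => TambaraFunctor.kaehlerD (R.boxInl (TambaraFunctor.free D (orbit H)))
          (R.polyGen (orbit H)))) ∧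
    -- for finitely many generators, `Ω` is free on the generators `δ (1 ⊗ x_i)` at `G/H i`
    (∀ (n : ℕ) (H : Fin n → Subgroup G),
      TambaraFunctor.Mod.IsBasis.{u, 0, max (u + 1) w, max (u + 1) w, w''}
        (TambaraFunctor.kaehler
          (R.boxInl (TambaraFunctor.freeBox D n fun i => orbit (H i))))
        (fun i : Fin n => orbit (H i))
        (fun i => TambaraFunctor.kaehlerD
          (R.boxInl (TambaraFunctor.freeBox D n fun i => orbit (H i)))
          (R.polyGens n (fun i => orbit (H i)) i))) := by
  refine ⟨fun H M => ?_, fun H => ?_, fun n H => ?_⟩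
  -- A family indexed by a one-point type is a single element of `M(G/H)`.
  · have h := TambaraFunctor.bijective_der_box R
      (TambaraFunctor.isFreeOn_free.{u, 0} D (orbit H)) M
    refine ⟨fun d d' hd => h.1 (funext fun _ => hd), fun m => ?_⟩
    obtain ⟨d, hd⟩ := h.2 fun _ => m
    exact ⟨d, congrFun hd ⟨⟩⟩
  · exact TambaraFunctor.kaehler_isBasis _ (fun _ => R.polyGen (orbit H)) fun N =>
      TambaraFunctor.bijective_der_box R (TambaraFunctor.isFreeOn_free.{u, 0} D (orbit H)) N
  · exact TambaraFunctor.kaehler_isBasis _ (R.polyGens n fun i => orbit (H i)) fun N =>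
      TambaraFunctor.bijective_der_box R
        (TambaraFunctor.isFreeOn_freeBox D n fun i => orbit (H i)) N
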